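/- **Setting.** Let $\mathcal X\subset\mathbb R^k$, let $(\mathcal S,\mathbb P_{\mathcal S})$ be a probability space, $S\sim\mathbb P_{\mathcal S}$, and let $\Phi\subset\mathbb R^d$ be closed under componentwise minimum $\wedge$ and maximum $\vee$. Let $f(x,s)\in\mathbb R^D$ and $g(x,\phi,s)\in\mathbb R^J$ for $x\in\mathcal X$, $\phi\in\Phi$, $s\in\mathcal S$, and let $\|f(x,s)-f(x',s)\|_2\le L_f\|x-x'\|_2$ for all $s$ and all $x,x'\in\mathcal X$. For all $x\in\mathcal X$ and $s\in\mathcal S$ let $g(x,\cdot,s)$ be a lattice homomorphism on $\Phi$, i.e. compatible with componentwise $\wedge$ and $\vee$. Let $\mathcal X(\phi,s)=\{x\in\mathcal X: g(x,\phi,s)\le 0\}$ be compact for all $\phi\in\Phi$, $s\in\mathcal S$ (for instance a finite union of bounded closed convex polyhedra, as for mixed-integer linear programs). Put $\Delta^{D-1}=\{\theta\in\mathbb R^D:\theta\ge0,\ \sum_i\theta_i=1\}$. Let $\hat x^*:\mathcal S\to\mathcal X$ be an optimal solution map: for some $\theta^{\rm true}\in\Delta^{D-1}$, $\phi^{\rm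 true}\in\Phi$ and all $s$, the point $\hat x^*(s)$ maximizes $\theta^{{\rm true}\top}f(\cdot,s)$ over $\mathcal X(\phi^{\rm true},s)$. For $\lambda\ge0$ let $$\ell^{{\rm sub},\lambda}(\theta,\phi,s)=\Big(\max_{x\in\mathcal X(\phi,s)}\theta^\top f(x,s)-\theta^\top f(\hat x^*(s),s)\Big)_+ +\lambda\sum_{j=1}^J g_j(\hat x^*(s),\phi,s)_+ .$$ For $T\subset\mathcal S$ let $\phi^{\sup}(T)$ be the greatest $\phi\in\Phi$ with $g(\hat x^*(s),\phi,s)\le0$ for all $s\in T$; it is assumed to exist for every one-point set $T=\{s\}$. Write $\phi\sim\phi'$ if $\mathcal X(\phi,s)=\mathcal X(\phi',s)$ for $\mathbb P_{\mathcal S}$-a.e. $s$. Let $\|X\|_{\psi_2}=\inf\{t>0:\mathbb E\exp(X^2/t^2)\le2\}$, let $d^H$ be the Hausdorff distance, and set $$C(\hat x^*,\phi^{\rm true},S)=\big\|d^H(\mathcal X(\phi^{\rm true},S),\{\hat x^*(S)\})\big\|_{\psi_2}.$$ The random variable $d^H(\mathcal X(\phi^{\rm true},S),\{\hat x^*(S)\})$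 is assumed to be sub-Gaussian; it and the losses $\ell^{{\rm sub},\lambda}(\theta,\phi,S)$ are assumed measurable (all this is automatic if $\mathcal S$ is finite with all subsets measurable). Let $\delta\in\mathbb R^d_{\ge0}$ be such that every $\phi\in\Phi$ with $\phi^{\rm true}\le\phi\le\phi^{\rm true}+\delta$ satisfies $\phi\sim\phi^{\rm true}$. Let $N\ge1$, let $S^{(1)},\dots,S^{(N)}$ be i.i.d. copies of $S$, let $\phi^{*(N)}=\phi^{\sup}(\{S^{(1)},\dots,S^{(N)}\})$, and let $\theta^{*(N)}$ be any minimizer over $\Delta^{D-1}$, chosen as a function of the sample, of the empirical loss $\theta\mapsto\frac1N\sum_{n=1}^N\ell^{{\rm sub},0}(\theta,\phi^{*(N)},S^{(n)})$. Below, $\mathbb E$ denotes the expectation over $S$ with the learned parameters held fixed, and if an event is not measurable, $\mathbb P$ is its outer probability. **Claim.** (a) For every $u\ge0$, the event that $\phi^{*(N)}\sim\phi^{\rm true}$ and $$\mathbb E\,\ell^{{\rm sub},\lambda}(\theta^{*(N)},\phi^{*(N)},S)-\mathbb E\,\ell^{{\rm sub},\lambda}(\theta^{\rm true},\phi^{\rm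 true},S)\le\frac{44\,L_f\,C(\hat x^*,\phi^{\rm true},S)}{\sqrt N}\big(3.01\sqrt{D-1}+u\big)$$ both hold fails with probability at most $$\sum_{j=1}^d\mathbb P\big(\phi^{\sup}_j(\{S\})\ge\phi^{\rm true}_j+\delta_j\big)^N+3\exp(-3u^2).$$ (b) More generally, for all real $C>3\sqrt3$ and $u\ge0$, the same holds when the right-hand side of the inequality is replaced by $$\Big(1+\frac{\sqrt\pi}{\sqrt{\log2}}\Big)\frac{\sqrt6\,L_f\,C}{\sqrt N}\,C(\hat x^*,\phi^{\rm true},S)\,\big(3.01\sqrt{D-1}+u\big)$$ and $3\exp(-3u^2)$ is replaced by $2\big(\zeta(C^2/9-2)-1\big)\exp(-C^2u^2/9)$, where $\zeta$ is the Riemann zeta function. -/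

import Mathlib

open MeasureTheory ProbabilityTheory

namespace InvOpt

variable {𝒮 : Type*} {k D d J : ℕ}

/-- The feasible set `𝒳(φ, s) = {x ∈ 𝒳 | g(x, φ, s) ≤ 0}` (componentwise inequality). -/
def feasible (𝒳 : Set (EuclideanSpace ℝ (Fin k)))
    (g : EuclideanSpace ℝ (Fin k) → (Fin d → ℝ) → 𝒮 → (Fin J → ℝ))
    (φ : Fin d → ℝ) (s : 𝒮) : Set (EuclideanSpace ℝ (Fin k)) :=
  {x | x ∈ 𝒳 ∧ g x φ s ≤ 0}

/-- The objective function `θᵀ f(x, s)`. -/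
def objective (f : EuclideanSpace ℝ (Fin k) → 𝒮 → EuclideanSpace ℝ (Fin D))
    (θ : Fin D → ℝ) (x : EuclideanSpace ℝ (Fin k)) (s : 𝒮) : ℝ :=
  ∑ i, θ i * f x s i

/-- The set of optimal solutions of the forward problem: maximize `θᵀ f(x, s)` over `𝒳(φ, s)`. -/
def FOP (𝒳 : Set (EuclideanSpace ℝ (Fin k)))
    (f : EuclideanSpace ℝ (Fin k) → 𝒮 → EuclideanSpace ℝ (Fin D))
    (g : EuclideanSpace ℝ (Fin k) → (Fin d → ℝ) → 𝒮 → (Fin J → ℝ))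
    (θ : Fin D → ℝ) (φ : Fin d → ℝ) (s : 𝒮) : Set (EuclideanSpace ℝ (Fin k)) :=
  {x | x ∈ feasible 𝒳 g φ s ∧ ∀ y ∈ feasible 𝒳 g φ s, objective f θ y s ≤ objective f θ x s}

/-- The suboptimality loss with penalty weight `lam`:
`ReLU (max_{y ∈ 𝒳(φ, s)} θᵀ f(y, s) - θᵀ f(x, s)) + lam * ∑ j, ReLU (g_j(x, φ, s))`. -/
noncomputable def suboptLoss (𝒳 : Set (EuclideanSpace ℝ (Fin k)))
    (f : EuclideanSpace ℝ (Fin k) → 𝒮 → EuclideanSpace ℝ (Fin D))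
    (g : EuclideanSpace ℝ (Fin k) → (Fin d → ℝ) → 𝒮 → (Fin J → ℝ))
    (lam : ℝ) (x : EuclideanSpace ℝ (Fin k)) (θ : Fin D → ℝ) (φ : Fin d → ℝ) (s : 𝒮) : ℝ :=
  max (sSup ((fun y => objective f θ y s) '' feasible 𝒳 g φ s) - objective f θ x s) 0
    + lam * ∑ j, max (g x φ s j) 0

/-- `h` restricted to `Φ` is a lattice homomorphism into `ℝ^J` with the componentwise order. -/
def IsLatticeHomOn (Φ : Set (Fin d → ℝ)) (h : (Fin d → ℝ) → (Fin J → ℝ)) : Prop :=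
  ∀ φ ∈ Φ, ∀ φ' ∈ Φ, h (φ ⊓ φ') = h φ ⊓ h φ' ∧ h (φ ⊔ φ') = h φ ⊔ h φ'

/-- `φ` is the learned constraint parameter `φ^sup(T)`: the greatest element of `Φ` for which the
observed solutions `xhat s`, `s ∈ T`, are all feasible. -/
def IsPhiSup (Φ : Set (Fin d → ℝ))
    (g : EuclideanSpace ℝ (Fin k) → (Fin d → ℝ) → 𝒮 → (Fin J → ℝ))
    (xhat : 𝒮 → EuclideanSpace ℝ (Fin k)) (T : Set 𝒮) (φ : Fin d → ℝ) : Prop :=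
  IsGreatest {ψ | ψ ∈ Φ ∧ ∀ s ∈ T, g (xhat s) ψ s ≤ 0} φ

/-- `φ ∼ φ'`: the feasible sets agree for almost every state. -/
def ParamEquiv [MeasurableSpace 𝒮] (P : Measure 𝒮) (𝒳 : Set (EuclideanSpace ℝ (Fin k)))
    (g : EuclideanSpace ℝ (Fin k) → (Fin d → ℝ) → 𝒮 → (Fin J → ℝ))
    (φ φ' : Fin d → ℝ) : Prop :=
  ∀ᵐ s ∂P, feasible 𝒳 g φ s = feasible 𝒳 g φ' s

/-- `(θ, φ)` is the outcome of completed learning on the sample `smp`: first `φ` is the greatest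
constraint parameter consistent with the sample, then `θ` minimizes over the probability simplex
the empirical suboptimality loss (without penalty term) for this `φ`. -/
def IsLearned (𝒳 : Set (EuclideanSpace ℝ (Fin k))) (Φ : Set (Fin d → ℝ))
    (f : EuclideanSpace ℝ (Fin k) → 𝒮 → EuclideanSpace ℝ (Fin D))
    (g : EuclideanSpace ℝ (Fin k) → (Fin d → ℝ) → 𝒮 → (Fin J → ℝ))
    (xhat : 𝒮 → EuclideanSpace ℝ (Fin k)) {N : ℕ} (smp : Fin N → 𝒮)
    (θ : Fin D → ℝ) (φ : Fin d → ℝ) : Prop :=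
  IsPhiSup Φ g xhat (Set.range smp) φ ∧
  θ ∈ stdSimplex ℝ (Fin D) ∧
  IsMinOn (fun θ' => (1 / (N : ℝ)) * ∑ n, suboptLoss 𝒳 f g 0 (xhat (smp n)) θ' φ (smp n))
    (stdSimplex ℝ (Fin D)) θ

/-- The numbers `t > 0` with `𝔼 exp (X² / t²) ≤ 2`. -/
def psi2Set [MeasurableSpace 𝒮] (P : Measure 𝒮) (X : 𝒮 → ℝ) : Set ℝ :=
  {t | 0 < t ∧ ∫⁻ s, ENNReal.ofReal (Real.exp (X s ^ 2 / t ^ 2)) ∂P ≤ 2}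

/-- `X` is sub-Gaussian: `𝔼 exp (X² / t²) ≤ 2` for some `t > 0`. -/
def IsSubGaussian [MeasurableSpace 𝒮] (P : Measure 𝒮) (X : 𝒮 → ℝ) : Prop :=
  (psi2Set P X).Nonempty

/-- The sub-Gaussian norm of a sub-Gaussian random variable. -/
noncomputable def psi2Norm [MeasurableSpace 𝒮] (P : Measure 𝒮) (X : 𝒮 → ℝ) : ℝ :=
  sInf (psi2Set P X)

/-- The Hausdorff distance between the feasible set `𝒳(φ, s)` and the singleton `{xhat s}`. -/
noncomputable def feasDist (𝒳 : Set (EuclideanSpace ℝ (Fin k)))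
    (g : EuclideanSpace ℝ (Fin k) → (Fin d → ℝ) → 𝒮 → (Fin J → ℝ))
    (xhat : 𝒮 → EuclideanSpace ℝ (Fin k)) (φ : Fin d → ℝ) (s : 𝒮) : ℝ :=
  Metric.hausdorffDist (feasible 𝒳 g φ s) {xhat s}

/-- The expected suboptimality loss of `(θ, φ)` at the observed solutions. -/
noncomputable def expLoss [MeasurableSpace 𝒮] (P : Measure 𝒮)
    (𝒳 : Set (EuclideanSpace ℝ (Fin k)))
    (f : EuclideanSpace ℝ (Fin k) → 𝒮 → EuclideanSpace ℝ (Fin D))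
    (g : EuclideanSpace ℝ (Fin k) → (Fin d → ℝ) → 𝒮 → (Fin J → ℝ))
    (xhat : 𝒮 → EuclideanSpace ℝ (Fin k)) (lam : ℝ) (θ : Fin D → ℝ) (φ : Fin d → ℝ) : ℝ :=
  ∫ s, suboptLoss 𝒳 f g lam (xhat s) θ φ s ∂P

end InvOpt

/-! Constraints. The observed points are feasible for `φtrue`, so `φtrue ≤ φN`; and `φN` lies below
the one-state parameter `φsup` of every sample point. Hence `φN` can exceed `φtrue + δ` in
coordinate `j` only if all `N` sample points satisfy `φtrue j + δ j ≤ φsup s j`. By independence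
this has probability at most an `N`-th power, and a union bound over `j` gives the sum. Otherwise
`φN` lies in the box on which all parameters are equivalent. Since `φN` depends on the sample,
equality of feasible sets at the sample points needs one null set for the whole box; `feasible_anti`
and a countable cofinal family (`exists_countable_cofinal`) provide it.

Objective. With the true feasible sets at the sample points, the empirical loss vanishes at `θtrue`,
hence at its minimizer `θN`. The excess loss is then a gap between mean and empirical mean, to be
bounded uniformly over the simplex. In `θ` the loss is Lipschitz with constant `|Lf|` times the
distance from the optimal point to the feasible set, and it lies between `0` and twice that constant
because it vanishes at `θtrue`.

The exponential moment of the supremum is bounded by passing to a ghost sample (Jensen) and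
inserting signs. For fixed pairs of points, Hoeffding's lemma controls the fluctuation about the
sign average, and a vector contraction argument based on Khintchine's inequality controls that
average (`signAvg_exp_iSup_le`). Integrating out the sub-Gaussian distance and applying Chernoff's
bound gives the tail `exp (-b ^ 2 / 24 + 2 * D)`. The constants claimed are generous enough to
absorb the dimension term without chaining; for `D = 1` the simplex is a point and the loss
vanishes. -/

namespace InvOpt

/-! ### Averages over random signs: Khintchine and Hoeffding -/

/-- The average of `F` over all vectors of signs. -/
noncomputable def signAvg : (n : ℕ) → ((Fin n → ℝ) → ℝ) → ℝ
  | 0, F => F Fin.elim0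
  | n + 1, F => (signAvg n (fun e => F (Fin.cons 1 e)) + signAvg n (fun e => F (Fin.cons (-1) e))) / 2

/-- The linear form with coefficients `v`. -/
def lin {n : ℕ} (v e : Fin n → ℝ) : ℝ := ∑ i, e i * v i

/-- The squared Euclidean length. -/
def sqLen {n : ℕ} (v : Fin n → ℝ) : ℝ := ∑ i, v i ^ 2

lemma sqLen_nonneg {n : ℕ} (v : Fin n → ℝ) : 0 ≤ sqLen v :=
  Finset.sum_nonneg fun _ _ => sq_nonneg _

lemma signAvg_mono {n : ℕ} {F G : (Fin n → ℝ) → ℝ} (h : ∀ e, F e ≤ G e) :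
    signAvg n F ≤ signAvg n G := by
  induction n with
  | zero => exact h _
  | succ n ih =>
    have h1 := ih (F := fun e => F (Fin.cons 1 e)) (G := fun e => G (Fin.cons 1 e)) fun e => h _
    have h2 := ih (F := fun e => F (Fin.cons (-1) e)) (G := fun e => G (Fin.cons (-1) e))
      fun e => h _
    simp only [signAvg]
    linarith

lemma signAvg_add {n : ℕ} (F G : (Fin n → ℝ) → ℝ) :
    signAvg n (fun e => F e + G e) = signAvg n F + signAvg n G := by
  induction n with
  | zero => rfl
  | succ n ih =>
    simp only [signAvg, ih]
    ring

lemma signAvg_mul {n : ℕ} (c : ℝ) (F : (Fin n → ℝ) → ℝ) :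
    signAvg n (fun e => c * F e) = c * signAvg n F := by
  induction n with
  | zero => rfl
  | succ n ih =>
    simp only [signAvg, ih]
    ring

lemma signAvg_const (n : ℕ) (c : ℝ) : signAvg n (fun _ => c) = c := by
  induction n with
  | zero => rfl
  | succ n ih => simp only [signAvg, ih]; ring

lemma signAvg_half_add {n : ℕ} (F G : (Fin n → ℝ) → ℝ) :
    signAvg n (fun e => (F e + G e) / 2) = (signAvg n F + signAvg n G) / 2 := by
  have h := signAvg_mul (1 / 2) (fun e => F e + G e)
  rw [signAvg_add] at h
  rw [show (fun e => (F e + G e) / 2) = fun e => 1 / 2 * (F e + G e) by funext e; ring, h]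
  ring

lemma signAvg_comm {n m : ℕ} (F : (Fin n → ℝ) → (Fin m → ℝ) → ℝ) :
    signAvg n (fun e => signAvg m (fun e' => F e e'))
      = signAvg m (fun e' => signAvg n (fun e => F e e')) := by
  induction n with
  | zero => rfl
  | succ n ih => simp only [signAvg, ih, signAvg_half_add]

lemma signAvg_neg {n : ℕ} (F : (Fin n → ℝ) → ℝ) :
    signAvg n (fun e => F (-e)) = signAvg n F := by
  induction n with
  | zero => exact congrArg F (Subsingleton.elim _ _)
  | succ n ih =>
    have key : ∀ (c : ℝ) (e : Fin n → ℝ),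
        -(Fin.cons c e : Fin (n + 1) → ℝ) = Fin.cons (-c) (-e) := by
      intro c e
      funext i
      refine Fin.cases ?_ (fun j => ?_) i <;> simp
    simp only [signAvg, key, neg_neg]
    rw [ih (fun e => F (Fin.cons (-1) e)), ih (fun e => F (Fin.cons 1 e))]
    ring

lemma lin_cons {n : ℕ} (v : Fin (n + 1) → ℝ) (c : ℝ) (e : Fin n → ℝ) :
    lin v (Fin.cons c e) = c * v 0 + lin (fun i => v i.succ) e := by
  simp [lin, Fin.sum_univ_succ]

lemma lin_neg {n : ℕ} (v e : Fin n → ℝ) : lin v (-e) = -lin v e := by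
  simp [lin]

lemma sqLen_succ {n : ℕ} (v : Fin (n + 1) → ℝ) :
    sqLen v = v 0 ^ 2 + sqLen (fun i => v i.succ) := by
  simp [sqLen, Fin.sum_univ_succ]

lemma signAvg_lin_sq {n : ℕ} (v : Fin n → ℝ) : signAvg n (fun e => lin v e ^ 2) = sqLen v := by
  induction n with
  | zero => simp [signAvg, lin, sqLen]
  | succ n ih =>
    simp only [signAvg, lin_cons]
    rw [← signAvg_half_add, sqLen_succ, ← ih, ← signAvg_const n (v 0 ^ 2), ← signAvg_add]
    congr 1
    funext e
    ring

lemma signAvg_lin_pow_four {n : ℕ} (v : Fin n → ℝ) :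
    signAvg n (fun e => lin v e ^ 4) ≤ 3 * sqLen v ^ 2 := by
  induction n with
  | zero => simp [signAvg, lin, sqLen]
  | succ n ih =>
    simp only [signAvg, lin_cons]
    rw [← signAvg_half_add, sqLen_succ]
    have h : (fun e : Fin n → ℝ => ((1 * v 0 + lin (fun i => v i.succ) e) ^ 4
        + (-1 * v 0 + lin (fun i => v i.succ) e) ^ 4) / 2)
        = fun e => v 0 ^ 4 + (6 * v 0 ^ 2 * lin (fun i => v i.succ) e ^ 2
          + lin (fun i => v i.succ) e ^ 4) := by
      funext e; ring
    rw [h, signAvg_add, signAvg_add, signAvg_mul, signAvg_const, signAvg_lin_sq]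
    nlinarith [ih (fun i => v i.succ), sq_nonneg (v 0 ^ 2)]

/-- Khintchine's inequality with the constant `2`. -/
lemma sqrt_sqLen_le_signAvg {n : ℕ} (v : Fin n → ℝ) :
    √(sqLen v) ≤ 2 * signAvg n (fun e => |lin v e|) := by
  rcases (sqLen_nonneg v).eq_or_lt with h0 | hpos
  · rw [← h0, Real.sqrt_zero]
    have := signAvg_mono (n := n) (F := fun _ => 0) (G := fun e => |lin v e|)
      fun e => abs_nonneg _
    rw [signAvg_const] at this
    linarith
  set r := √(sqLen v) with hr
  have hrpos : 0 < r := Real.sqrt_pos.2 hpos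
  have hr2 : r ^ 2 = sqLen v := Real.sq_sqrt hpos.le
  -- A quartic minorant of `|y|`: since the fourth moment is at most `3 * r ^ 4`, averaging it at
  -- `|lin v e| / r` gives at least `1 - 3 / 6 = 1 / 2`.
  have poly : ∀ y : ℝ, 0 ≤ y → y ^ 2 - y ^ 4 / 6 ≤ y := by
    intro y hy
    have : 0 ≤ 1 - y + y ^ 3 / 6 := by
      rcases le_total y 1 with h | h
      · have := pow_nonneg hy 3
        linarith
      -- The product `(y - 3/2)² (y + 3) = y³ - 27/4 * (y - 1)` leaves `(y - 1) / 8 ≥ 0`.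
      · nlinarith [mul_nonneg (sq_nonneg (y - 3 / 2)) (by linarith : 0 ≤ y + 3)]
    nlinarith [mul_nonneg hy this]
  have hpt : ∀ e, r⁻¹ * lin v e ^ 2 + (-(r⁻¹ ^ 3 / 6)) * lin v e ^ 4 ≤ |lin v e| := by
    intro e
    have h := poly (|lin v e| / r) (by positivity)
    rw [div_pow, div_pow, sq_abs, show |lin v e| ^ 4 = lin v e ^ 4 from Even.pow_abs ⟨2, rfl⟩ _] at h
    have h2 := mul_le_mul_of_nonneg_left h hrpos.le
    calc _ = r * (lin v e ^ 2 / r ^ 2 - lin v e ^ 4 / r ^ 4 / 6) := by field_simp; ring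
      _ ≤ _ := h2
      _ = _ := by field_simp
  have h := signAvg_mono hpt
  rw [signAvg_add, signAvg_mul, signAvg_mul, signAvg_lin_sq, ← hr2] at h
  have h4 := signAvg_lin_pow_four v
  rw [← hr2] at h4
  have h5 : r⁻¹ ^ 3 / 6 * signAvg n (fun e => lin v e ^ 4) ≤ r⁻¹ ^ 3 / 6 * (3 * (r ^ 2) ^ 2) :=
    mul_le_mul_of_nonneg_left h4 (by positivity)
  have h6 : r⁻¹ ^ 3 / 6 * (3 * (r ^ 2) ^ 2) = r / 2 := by field_simp; norm_num
  have h7 : r⁻¹ * r ^ 2 = r := by field_simp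
  linarith

/-- Iterated Hoeffding lemma for a function of signs with bounded differences. -/
lemma signAvg_exp_le {n : ℕ} (c : Fin n → ℝ) (F : (Fin n → ℝ) → ℝ)
    (hF : ∀ e e' : Fin n → ℝ, F e - F e' ≤ ∑ i, c i * |e i - e' i|) :
    signAvg n (fun e => Real.exp (F e)) ≤ Real.exp (signAvg n F + ∑ i, c i ^ 2 / 2) := by
  induction n with
  | zero => simp [signAvg]
  | succ n ih =>
    set R := ∑ i : Fin n, c i.succ ^ 2 / 2 with hR
    have step : ∀ b : ℝ, signAvg n (fun e => Real.exp (F (Fin.cons b e)))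
        ≤ Real.exp (signAvg n (fun e => F (Fin.cons b e)) + R) := fun b =>
      ih (fun i => c i.succ) (fun e => F (Fin.cons b e)) fun e e' => by
        simpa [Fin.sum_univ_succ] using hF (Fin.cons b e) (Fin.cons b e')
    have hdiff : ∀ b b' : ℝ, |b - b'| ≤ 2 → 0 ≤ c 0 →
        signAvg n (fun e => F (Fin.cons b e))
          ≤ signAvg n (fun e => F (Fin.cons b' e)) + 2 * c 0 := by
      intro b b' hb hc
      rw [← signAvg_const n (2 * c 0), ← signAvg_add]
      refine signAvg_mono fun e => ?_
      have h := hF (Fin.cons b e) (Fin.cons b' e)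
      simp only [Fin.sum_univ_succ, Fin.cons_zero, Fin.cons_succ, sub_self, abs_zero, mul_zero,
        Finset.sum_const_zero, add_zero] at h
      nlinarith [mul_le_mul_of_nonneg_left hb hc]
    have hc : 0 ≤ c 0 := by
      have h1 := hF (Fin.cons 1 0) (Fin.cons (-1) 0)
      have h2 := hF (Fin.cons (-1) 0) (Fin.cons 1 0)
      simp only [Fin.sum_univ_succ, Fin.cons_zero, Fin.cons_succ, sub_self, abs_zero, mul_zero,
        Finset.sum_const_zero, add_zero] at h1 h2
      norm_num at h1 h2
      linarith
    have h1 := hdiff 1 (-1) (by norm_num) hc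
    have h2 := hdiff (-1) 1 (by norm_num) hc
    have s1 := step 1
    have s2 := step (-1)
    simp only [signAvg]
    set p := signAvg n (fun e => F (Fin.cons 1 e))
    set q := signAvg n (fun e => F (Fin.cons (-1) e))
    rw [Fin.sum_univ_succ, ← hR]
    calc _ ≤ (Real.exp (p + R) + Real.exp (q + R)) / 2 := by linarith
      -- Flipping a sign moves it by `2`, so half the difference of the conditional averages `p`,
      -- `q` is at most `c 0`, and `cosh t ≤ exp (t ^ 2 / 2)` applies.
      _ = Real.exp ((p + q) / 2 + R) * Real.cosh ((p - q) / 2) := by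
        rw [Real.cosh_eq, ← mul_div_assoc, mul_add, ← Real.exp_add, ← Real.exp_add]
        ring_nf
      _ ≤ Real.exp ((p + q) / 2 + R) * Real.exp (c 0 ^ 2 / 2) := by
        gcongr
        refine (Real.cosh_le_exp_half_sq _).trans (Real.exp_le_exp.2 ?_)
        have : ((p - q) / 2) ^ 2 ≤ c 0 ^ 2 := sq_le_sq' (by linarith) (by linarith)
        linarith
      _ = _ := by rw [← Real.exp_add]; ring_nf

lemma signAvg_sqrt_le {n : ℕ} (F : (Fin n → ℝ) → ℝ) (hF : ∀ e, 0 ≤ F e) :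
    signAvg n (fun e => √(F e)) ≤ √(signAvg n F) := by
  set m := signAvg n (fun e => √(F e)) with hm
  refine Real.le_sqrt_of_sq_le ?_
  have h : (0 : ℝ) ≤ signAvg n (fun e => (√(F e) - m) ^ 2) := by
    rw [← signAvg_const n 0]
    exact signAvg_mono fun e => sq_nonneg _
  have h2 : (fun e => (√(F e) - m) ^ 2) = fun e => F e + ((-2 * m) * √(F e) + m ^ 2) := by
    funext e
    rw [sub_sq, Real.sq_sqrt (hF e)]
    ring
  rw [h2, signAvg_add, signAvg_add, signAvg_mul, signAvg_const, ← hm] at h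
  linarith

lemma signAvg_sqLen_add {n : ℕ} (y : Fin n → ℝ) (c : ℝ) :
    signAvg n (fun e => sqLen (fun i => y i + c * e i)) = sqLen y + c ^ 2 * n := by
  induction n with
  | zero => simp [signAvg, sqLen]
  | succ n ih =>
    simp only [signAvg, sqLen_succ, Fin.cons_zero, Fin.cons_succ, signAvg_add, signAvg_const]
    rw [ih (fun i => y i.succ)]
    push_cast
    ring

/-! ### Vector contraction and Rademacher suprema -/

section Contraction

variable {ι : Type*} [Finite ι] {D : ℕ}

lemma le_iSup_fin (v : ι → ℝ) (i : ι) : v i ≤ ⨆ i, v i :=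
  le_ciSup (Set.finite_range v).bddAbove i

variable [Nonempty ι]

/-- One step of the vector contraction inequality. -/
lemma half_iSup_add_iSup_le (θ : ι → Fin D → ℝ) (ψ H : ι → ℝ) {a : ℝ} (ha : 0 ≤ a)
    (hH : ∀ i j, H i - H j ≤ a * √(sqLen (θ i - θ j))) :
    ((⨆ i, (ψ i + H i)) + ⨆ i, (ψ i - H i)) / 2
      ≤ signAvg D (fun e => ⨆ i, (ψ i + 2 * a * lin (θ i) e)) := by
  obtain ⟨i, hi⟩ := exists_eq_ciSup_of_finite (f := fun i => ψ i + H i)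
  obtain ⟨j, hj⟩ := exists_eq_ciSup_of_finite (f := fun i => ψ i - H i)
  rw [← hi, ← hj]
  set G : (Fin D → ℝ) → ℝ := fun e => ⨆ i, (ψ i + 2 * a * lin (θ i) e) with hG
  have hk := mul_le_mul_of_nonneg_left (sqrt_sqLen_le_signAvg (θ i - θ j)) ha
  -- With `i`, `j` the maximizers, Khintchine bounds `H i - H j` by an average of `|lin (θ i - θ j)
  -- e|`. The absolute value disappears on pairing `e` with `-e`: one of the two signs favours `i`,
  -- the other `j`.
  have hpt : ∀ e, (ψ i + ψ j) + (2 * a) * |lin (θ i - θ j) e| ≤ G e + G (-e) := by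
    intro e
    have hl : lin (θ i - θ j) e = lin (θ i) e - lin (θ j) e := by
      simp [lin, mul_sub]
    have h1 : ∀ k e, ψ k + 2 * a * lin (θ k) e ≤ G e := fun k e =>
      le_iSup_fin (fun i => ψ i + 2 * a * lin (θ i) e) k
    have h2 := h1 i e
    have h3 := h1 j (-e)
    have h4 := h1 j e
    have h5 := h1 i (-e)
    rw [lin_neg] at h3 h5
    rw [hl]
    rcases abs_cases (lin (θ i) e - lin (θ j) e) with ⟨h, _⟩ | ⟨h, _⟩ <;> rw [h] <;> linarith
  have h := signAvg_mono hpt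
  rw [signAvg_add (fun _ => ψ i + ψ j), signAvg_add G, signAvg_const D (ψ i + ψ j), signAvg_mul,
    signAvg_neg] at h
  have := hH i j
  linarith

/-- Each step trades one scalar sign for a vector of `D` signs scaled by `2 * a m`, which is
absorbed into the drift `y`; this is why `y` must be general in the induction. Once only the drift
is left, Cauchy-Schwarz bounds the supremum by its length, whose mean square has grown by `4 * D * a
m ^ 2` per step. -/
lemma signAvg_iSup_le (θ : ι → Fin D → ℝ) (hθ : ∀ i, sqLen (θ i) ≤ 1) {n : ℕ}
    (H : Fin n → ι → ℝ) (a : Fin n → ℝ) (ha : ∀ m, 0 ≤ a m)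
    (hH : ∀ m i j, H m i - H m j ≤ a m * √(sqLen (θ i - θ j))) (y : Fin D → ℝ) :
    signAvg n (fun ε => ⨆ i, (lin (θ i) y + ∑ m, ε m * H m i))
      ≤ √(sqLen y + 4 * D * ∑ m, a m ^ 2) := by
  induction n generalizing y with
  | zero =>
    simp only [signAvg, Finset.univ_eq_empty, Finset.sum_empty, add_zero, mul_zero]
    refine ciSup_le fun i => Real.le_sqrt_of_sq_le ?_
    have := Finset.sum_mul_sq_le_sq_mul_sq Finset.univ y (θ i)
    refine this.trans ?_
    exact mul_le_of_le_one_right (sqLen_nonneg y) (hθ i)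
  | succ n ih =>
    have hstep : ∀ e : Fin D → ℝ,
        signAvg n (fun ε => ⨆ i, ((lin (θ i) y + ∑ m, ε m * H m.succ i)
          + 2 * a 0 * lin (θ i) e))
        ≤ √(sqLen (fun k => y k + 2 * a 0 * e k) + 4 * D * ∑ m : Fin n, a m.succ ^ 2) := by
      intro e
      have := ih (fun m => H m.succ) (fun m => a m.succ) (fun m => ha _) (fun m => hH _)
        (fun k => y k + 2 * a 0 * e k)
      convert this using 5 with ε i
      have : lin (θ i) (fun k => y k + 2 * a 0 * e k) = lin (θ i) y + 2 * a 0 * lin (θ i) e := by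
        simp only [lin, add_mul, Finset.sum_add_distrib, Finset.mul_sum, mul_assoc]
      rw [this]
      ring
    have hpt : ∀ ε : Fin n → ℝ,
        ((⨆ i, (lin (θ i) y + (1 * H 0 i + ∑ m, ε m * H m.succ i)))
          + ⨆ i, (lin (θ i) y + (-1 * H 0 i + ∑ m, ε m * H m.succ i))) / 2
        ≤ signAvg D (fun e => ⨆ i, ((lin (θ i) y + ∑ m, ε m * H m.succ i)
          + 2 * a 0 * lin (θ i) e)) := by
      intro ε
      refine le_trans (le_of_eq ?_) (half_iSup_add_iSup_le θ
        (fun i => lin (θ i) y + ∑ m, ε m * H m.succ i) (H 0) (ha 0) (hH 0))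
      congr 3
      · funext i; ring
      · funext i; ring
    simp only [signAvg, Fin.sum_univ_succ, Fin.cons_zero, Fin.cons_succ]
    rw [← signAvg_half_add]
    refine (signAvg_mono hpt).trans ?_
    rw [signAvg_comm]
    refine (signAvg_mono hstep).trans ((signAvg_sqrt_le _ fun e => ?_).trans ?_)
    · have := sqLen_nonneg (fun k => y k + 2 * a 0 * e k)
      positivity
    · rw [signAvg_add, signAvg_const, signAvg_sqLen_add]
      refine Real.sqrt_le_sqrt (le_of_eq ?_)
      ring

/-- The exponential moment of a Rademacher supremum over functions which are Lipschitz in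
a parameter from the unit ball of `ℝ^D`. -/
lemma signAvg_exp_iSup_le (θ : ι → Fin D → ℝ) (hθ : ∀ i, sqLen (θ i) ≤ 1) {n : ℕ}
    (H : Fin n → ι → ℝ) (a r : Fin n → ℝ) (ha : ∀ m, 0 ≤ a m)
    (hH : ∀ m i j, H m i - H m j ≤ a m * √(sqLen (θ i - θ j)))
    (hr : ∀ m i, |H m i| ≤ r m) {τ : ℝ} (hτ : 0 ≤ τ) :
    signAvg n (fun ε => Real.exp (τ * ⨆ i, ∑ m, ε m * H m i))
      ≤ Real.exp (2 * D + ∑ m, τ ^ 2 * (a m ^ 2 + r m ^ 2) / 2) := by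
  refine (signAvg_exp_le (fun m => τ * r m) _ fun e e' => ?_).trans (Real.exp_le_exp.2 ?_)
  · obtain ⟨i, hi⟩ := exists_eq_ciSup_of_finite (f := fun i => ∑ m, e m * H m i)
    have hle := le_iSup_fin (fun i => ∑ m, e' m * H m i) i
    rw [← hi, ← mul_sub]
    calc τ * ((∑ m, e m * H m i) - ⨆ i, ∑ m, e' m * H m i)
        ≤ τ * ((∑ m, e m * H m i) - ∑ m, e' m * H m i) := by gcongr
      _ = ∑ m, τ * ((e m - e' m) * H m i) := by
        rw [← Finset.sum_sub_distrib, Finset.mul_sum]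
        exact Finset.sum_congr rfl fun m _ => by ring
      _ ≤ ∑ m, τ * r m * |e m - e' m| := by
        refine Finset.sum_le_sum fun m _ => ?_
        rw [mul_assoc]
        refine mul_le_mul_of_nonneg_left ?_ hτ
        refine (le_abs_self _).trans ?_
        rw [abs_mul, mul_comm]
        exact mul_le_mul_of_nonneg_right (hr m i) (abs_nonneg _)
  · have h := signAvg_iSup_le θ hθ H a ha hH 0
    have h0 : ∀ i, lin (θ i) 0 = 0 := fun i => by simp [lin]
    have h1 : sqLen (0 : Fin D → ℝ) = 0 := by simp [sqLen]
    simp only [h0, h1, zero_add] at h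
    rw [signAvg_mul]
    set A := ∑ m, a m ^ 2 with hA
    have hA0 : 0 ≤ A := Finset.sum_nonneg fun _ _ => sq_nonneg _
    have h2 : √(4 * D * A) = 2 * √(D : ℝ) * √A := by
      rw [mul_assoc, Real.sqrt_mul (by norm_num), Real.sqrt_mul (by positivity),
        show (4 : ℝ) = 2 ^ 2 by norm_num, Real.sqrt_sq (by norm_num)]
      ring
    rw [h2] at h
    have h3 : ∑ m, τ ^ 2 * (a m ^ 2 + r m ^ 2) / 2
        = τ ^ 2 * A / 2 + ∑ m, (τ * r m) ^ 2 / 2 := by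
      rw [hA, Finset.mul_sum, Finset.sum_div, ← Finset.sum_add_distrib]
      exact Finset.sum_congr rfl fun m _ => by ring
    rw [h3]
    have h4 := mul_le_mul_of_nonneg_left h hτ
    have hD := Real.sq_sqrt (Nat.cast_nonneg (α := ℝ) D)
    have hA' := Real.sq_sqrt hA0
    have h5 : τ ^ 2 * A = (τ * √A) ^ 2 := by rw [mul_pow, hA']
    -- Arithmetic-geometric mean: `2 * τ * √D * √A ≤ 2 * D + τ ^ 2 * A / 2`.
    nlinarith [sq_nonneg (2 * √(D : ℝ) - τ * √A)]

end Contraction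

/-! ### Exponential moments under Jensen and random signs -/

lemma exp_lintegral_le {𝒮 : Type*} [MeasurableSpace 𝒮] (P : Measure 𝒮) [IsProbabilityMeasure P]
    {Y : 𝒮 → ℝ} (hY : Integrable Y P) :
    ENNReal.ofReal (Real.exp (∫ s, Y s ∂P)) ≤ ∫⁻ s, ENNReal.ofReal (Real.exp (Y s)) ∂P := by
  by_cases hfin : ∫⁻ s, ENNReal.ofReal (Real.exp (Y s)) ∂P = ⊤
  · rw [hfin]; exact le_top
  have hint : Integrable (fun s => Real.exp (Y s)) P := by
    refine ⟨Real.continuous_exp.comp_aestronglyMeasurable hY.1, ?_⟩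
    rw [hasFiniteIntegral_iff_ofReal (Filter.Eventually.of_forall fun s => (Real.exp_pos _).le)]
    exact lt_top_iff_ne_top.2 hfin
  rw [← ofReal_integral_eq_lintegral_ofReal hint
    (Filter.Eventually.of_forall fun s => (Real.exp_pos _).le)]
  exact ENNReal.ofReal_le_ofReal (convexOn_exp.map_integral_le Real.continuous_exp.continuousOn
    isClosed_univ (by simp) hY hint)

/-- By convexity `exp (p * y) ≤ 1 - p + p * exp y` for `0 ≤ p ≤ 1`. Integrating with moment at most
`2` gives `1 + p ≤ exp p`. -/
lemma lintegral_exp_mul_sq_le {𝒮 : Type*} [MeasurableSpace 𝒮] (P : Measure 𝒮)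
    [IsProbabilityMeasure P] {X : 𝒮 → ℝ} {K α : ℝ} (hK0 : 0 < K) (hα : 0 ≤ α)
    (hαK : α * K ^ 2 ≤ 1)
    (hK : ∫⁻ s, ENNReal.ofReal (Real.exp (X s ^ 2 / K ^ 2)) ∂P ≤ 2) :
    ∫⁻ s, ENNReal.ofReal (Real.exp (α * X s ^ 2)) ∂P ≤ ENNReal.ofReal (Real.exp (α * K ^ 2)) := by
  set p := α * K ^ 2 with hp
  have hp0 : 0 ≤ p := by positivity
  have hpt : ∀ s, ENNReal.ofReal (Real.exp (α * X s ^ 2))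
      ≤ ENNReal.ofReal (1 - p) + ENNReal.ofReal p * ENNReal.ofReal (Real.exp (X s ^ 2 / K ^ 2)) := by
    intro s
    rw [← ENNReal.ofReal_mul hp0, ← ENNReal.ofReal_add (by linarith) (by positivity)]
    refine ENNReal.ofReal_le_ofReal ?_
    have h := convexOn_exp.2 (Set.mem_univ (0 : ℝ)) (Set.mem_univ (X s ^ 2 / K ^ 2))
      (by linarith : 0 ≤ 1 - p) hp0 (by ring)
    simp only [smul_eq_mul, mul_zero, zero_add, Real.exp_zero, mul_one] at h
    rwa [show α * X s ^ 2 = p * (X s ^ 2 / K ^ 2) by rw [hp]; field_simp]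
  refine (lintegral_mono hpt).trans ?_
  rw [lintegral_add_left measurable_const, lintegral_const, measure_univ, mul_one,
    lintegral_const_mul' _ _ ENNReal.ofReal_ne_top]
  calc _ ≤ ENNReal.ofReal (1 - p) + ENNReal.ofReal p * 2 := by gcongr
    _ = ENNReal.ofReal (1 + p) := by
      rw [show (2 : ENNReal) = ENNReal.ofReal 2 by simp, ← ENNReal.ofReal_mul hp0,
        ← ENNReal.ofReal_add (by linarith) (by positivity)]
      congr 1; ring
    _ ≤ _ := ENNReal.ofReal_le_ofReal (by linarith [Real.add_one_le_exp p])

lemma measurable_signAvg {Z : Type*} [MeasurableSpace Z] {n : ℕ} (G : (Fin n → ℝ) → Z → ℝ)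
    (hG : ∀ e, Measurable (G e)) : Measurable fun z => signAvg n (fun e => G e z) := by
  induction n with
  | zero => exact hG _
  | succ n ih =>
    exact ((ih (fun e => G (Fin.cons 1 e)) fun e => hG _).add
      (ih (fun e => G (Fin.cons (-1) e)) fun e => hG _)).div_const 2

lemma lintegral_signAvg {Z : Type*} [MeasurableSpace Z] (Q : Measure Z) {n : ℕ}
    (G : (Fin n → ℝ) → Z → ℝ) (hG : ∀ e, Measurable (G e)) (h0 : ∀ e z, 0 ≤ G e z) (I : ENNReal)
    (hI : ∀ e, (∀ i, e i = 1 ∨ e i = -1) → ∫⁻ z, ENNReal.ofReal (G e z) ∂Q = I) :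
    ∫⁻ z, ENNReal.ofReal (signAvg n (fun e => G e z)) ∂Q = I := by
  induction n with
  | zero => exact hI _ fun i => i.elim0
  | succ n ih =>
    have hcons : ∀ c : ℝ, (c = 1 ∨ c = -1) → ∀ e : Fin n → ℝ, (∀ i, e i = 1 ∨ e i = -1) →
        ∀ i, (Fin.cons c e : Fin (n + 1) → ℝ) i = 1 ∨ (Fin.cons c e : Fin (n + 1) → ℝ) i = -1 := by
      intro c hc e he i
      refine Fin.cases ?_ (fun j => ?_) i
      · simpa using hc
      · simpa using he j
    have h1 := ih (fun e => G (Fin.cons 1 e)) (fun e => hG _) (fun e => h0 _)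
      fun e he => hI _ (hcons 1 (Or.inl rfl) e he)
    have h2 := ih (fun e => G (Fin.cons (-1) e)) (fun e => hG _) (fun e => h0 _)
      fun e he => hI _ (hcons (-1) (Or.inr rfl) e he)
    have hn : ∀ c z, 0 ≤ signAvg n (fun e => G (Fin.cons c e) z) := by
      intro c z
      rw [← signAvg_const n 0]
      exact signAvg_mono fun e => h0 _ _
    simp only [signAvg]
    have hsplit : ∀ z, ENNReal.ofReal ((signAvg n (fun e => G (Fin.cons 1 e) z)
        + signAvg n (fun e => G (Fin.cons (-1) e) z)) / 2)
        = ENNReal.ofReal (signAvg n (fun e => G (Fin.cons 1 e) z)) / 2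
          + ENNReal.ofReal (signAvg n (fun e => G (Fin.cons (-1) e) z)) / 2 := by
      intro z
      rw [ENNReal.ofReal_div_of_pos two_pos, ENNReal.ofReal_add (hn _ _) (hn _ _),
        ENNReal.ofReal_ofNat, ENNReal.add_div]
    rw [lintegral_congr hsplit]
    simp only [div_eq_mul_inv]
    have hm : ∀ c, Measurable fun z =>
        ENNReal.ofReal (signAvg n (fun e => G (Fin.cons c e) z)) := fun c =>
      (measurable_signAvg (fun e => G (Fin.cons c e)) fun e => hG _).ennreal_ofReal
    rw [lintegral_add_left ((hm 1).mul_const _), lintegral_mul_const _ (hm 1),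
      lintegral_mul_const _ (hm (-1)), h1, h2, ← div_eq_mul_inv, ENNReal.add_halves]

lemma signAvg_exp_iSup_diff_le {𝒮 : Type*} {ι : Type*} [Finite ι] [Nonempty ι] {D N : ℕ}
    (θ : ι → Fin D → ℝ) (hθ : ∀ i, sqLen (θ i) ≤ 1)
    (h : ι → 𝒮 → ℝ) (dd : 𝒮 → ℝ)
    (hL : ∀ s i j, h i s - h j s ≤ dd s * √(sqLen (θ i - θ j)))
    (h0 : ∀ i s, 0 ≤ h i s) (h2 : ∀ i s, h i s ≤ 2 * dd s) {τ : ℝ} (hτ : 0 ≤ τ)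
    (z : Fin N → 𝒮 × 𝒮) :
    signAvg N (fun e => Real.exp (τ * ⨆ i, ∑ n : Fin N, e n * (h i (z n).2 - h i (z n).1)))
      ≤ Real.exp (2 * D + ∑ n, (3 * τ ^ 2 * dd (z n).1 ^ 2 + 3 * τ ^ 2 * dd (z n).2 ^ 2)) := by
  have hd0 : ∀ s, 0 ≤ dd s := fun s => by
    have i := Classical.arbitrary ι
    linarith [h0 i s, h2 i s]
  -- The Lipschitz constants of a pair add up, but its range is only twice the maximum, because both
  -- terms lie between `0` and `2 * dd`. Together `a² + r² ≤ 6 * (d₁² + d₂²)`, whose half is the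
  -- factor `3`.
  refine (signAvg_exp_iSup_le θ hθ (fun n i => h i (z n).2 - h i (z n).1)
    (fun n => dd (z n).2 + dd (z n).1) (fun n => 2 * max (dd (z n).1) (dd (z n).2))
    (fun n => add_nonneg (hd0 _) (hd0 _)) (fun n i j => ?_) (fun n i => ?_) hτ).trans
    (Real.exp_le_exp.2 (add_le_add le_rfl (Finset.sum_le_sum fun n _ => ?_)))
  · have e1 := hL (z n).2 i j
    have e2 := hL (z n).1 j i
    have e3 : sqLen (θ j - θ i) = sqLen (θ i - θ j) := by
      simp only [sqLen, Pi.sub_apply]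
      exact Finset.sum_congr rfl fun k _ => by ring
    rw [e3] at e2
    linarith
  · have e1 := h0 i (z n).1
    have e2 := h0 i (z n).2
    have e3 := h2 i (z n).1
    have e4 := h2 i (z n).2
    have e5 := le_max_left (dd (z n).1) (dd (z n).2)
    have e6 := le_max_right (dd (z n).1) (dd (z n).2)
    rw [abs_le]
    constructor <;> linarith
  · have hmax : max (dd (z n).1) (dd (z n).2) ^ 2 ≤ dd (z n).1 ^ 2 + dd (z n).2 ^ 2 := by
      rcases max_cases (dd (z n).1) (dd (z n).2) with ⟨e, _⟩ | ⟨e, _⟩ <;> rw [e]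
      · linarith [sq_nonneg (dd (z n).2)]
      · linarith [sq_nonneg (dd (z n).1)]
    have hsum : (dd (z n).2 + dd (z n).1) ^ 2 ≤ 2 * (dd (z n).1 ^ 2 + dd (z n).2 ^ 2) := by
      linarith [sq_nonneg (dd (z n).2 - dd (z n).1)]
    have : (dd (z n).2 + dd (z n).1) ^ 2 + (2 * max (dd (z n).1) (dd (z n).2)) ^ 2
        ≤ 6 * (dd (z n).1 ^ 2 + dd (z n).2 ^ 2) := by
      rw [mul_pow]; linarith
    have := mul_le_mul_of_nonneg_left this (sq_nonneg τ)
    linarith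

/-! ### Symmetrization with a ghost sample -/

section Symmetrization

variable {𝒮 : Type*} [MeasurableSpace 𝒮] (P : Measure 𝒮) [IsProbabilityMeasure P]
  {ι : Type*} [Finite ι] {D N : ℕ}

/-- A sign `-1` amounts to swapping the two members of a pair, which preserves `P.prod P`. -/
lemma lintegral_exp_iSup_sign_flip (h : ι → 𝒮 → ℝ) (hm : ∀ i, Measurable (h i)) (τ : ℝ)
    (e : Fin N → ℝ) (he : ∀ n, e n = 1 ∨ e n = -1) :
    ∫⁻ z, ENNReal.ofReal (Real.exp (τ * ⨆ i, ∑ n : Fin N, e n * (h i (z n).2 - h i (z n).1)))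
        ∂(Measure.pi fun _ : Fin N => P.prod P)
      = ∫⁻ z, ENNReal.ofReal (Real.exp (τ * ⨆ i, ∑ n : Fin N, (h i (z n).2 - h i (z n).1)))
        ∂(Measure.pi fun _ : Fin N => P.prod P) := by
  classical
  let σ : Fin N → 𝒮 × 𝒮 → 𝒮 × 𝒮 := fun n => if e n = 1 then id else Prod.swap
  have hσ : ∀ n, MeasurePreserving (σ n) (P.prod P) (P.prod P) := by
    intro n
    by_cases hn : e n = 1
    · simp only [σ, hn, if_true]; exact MeasurePreserving.id _
    · simp only [σ, hn, if_false]; exact Measure.measurePreserving_swap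
  have hpi := measurePreserving_pi _ _ hσ
  have hG : Measurable fun z : Fin N → 𝒮 × 𝒮 =>
      ENNReal.ofReal (Real.exp (τ * ⨆ i, ∑ n : Fin N, (h i (z n).2 - h i (z n).1))) := by
    refine (Real.measurable_exp.comp (Measurable.const_mul ?_ τ)).ennreal_ofReal
    refine Measurable.iSup fun i => ?_
    refine Finset.measurable_fun_sum _ fun n _ => ?_
    exact ((hm i).comp (by fun_prop)).sub ((hm i).comp (by fun_prop))
  rw [← hpi.lintegral_comp hG]
  refine lintegral_congr fun z => ?_
  have hterm : ∀ i n, e n * (h i (z n).2 - h i (z n).1)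
      = h i (σ n (z n)).2 - h i (σ n (z n)).1 := by
    intro i n
    rcases he n with hn | hn
    · simp [σ, hn]
    · simp only [σ, hn, if_neg (by norm_num : ¬ (-1 : ℝ) = 1), Prod.fst_swap, Prod.snd_swap]
      ring
  simp only [hterm]

lemma lintegral_pi_prod_eq_pow {Z : Type*} [MeasurableSpace Z] (Q : Measure Z)
    [IsProbabilityMeasure Q] {E : Z → ENNReal} (hE : Measurable E) :
    ∫⁻ z, ∏ n, E (z n) ∂(Measure.pi fun _ : Fin N => Q) = (∫⁻ w, E w ∂Q) ^ N := by
  have hind : iIndepFun (fun (n : Fin N) (z : Fin N → Z) => E (z n))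
      (Measure.pi fun _ : Fin N => Q) :=
    iIndepFun_pi fun _ => hE.aemeasurable
  rw [lintegral_prod_eq_prod_lintegral_of_indepFun Finset.univ _ hind
    fun n => hE.comp (measurable_pi_apply n)]
  have h1 : ∀ n : Fin N, ∫⁻ z : Fin N → Z, E (z n) ∂(Measure.pi fun _ : Fin N => Q)
      = ∫⁻ w, E w ∂Q := fun n =>
    (measurePreserving_eval (fun _ : Fin N => Q) n).lintegral_comp hE
  simp only [h1, Finset.prod_const, Finset.card_univ, Fintype.card_fin]

lemma lintegral_exp_sum_sq_le (dd : 𝒮 → ℝ) (hdm : Measurable dd)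
    {K : ℝ} (hK0 : 0 < K) (hK : ∫⁻ s, ENNReal.ofReal (Real.exp (dd s ^ 2 / K ^ 2)) ∂P ≤ 2)
    {β : ℝ} (hβ : 0 ≤ β) (hβK : β * K ^ 2 ≤ 1) :
    ∫⁻ z, ENNReal.ofReal (Real.exp (∑ n, (β * dd (z n).1 ^ 2 + β * dd (z n).2 ^ 2)))
        ∂(Measure.pi fun _ : Fin N => P.prod P)
      ≤ ENNReal.ofReal (Real.exp (2 * N * β * K ^ 2)) := by
  obtain ⟨E, hEdef⟩ : ∃ E : 𝒮 → ENNReal, E = fun s => ENNReal.ofReal (Real.exp (β * dd s ^ 2)) :=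
    ⟨_, rfl⟩
  have hE : Measurable E := by
    rw [hEdef]
    exact (Real.measurable_exp.comp ((hdm.pow_const 2).const_mul _)).ennreal_ofReal
  have hEE : Measurable fun w : 𝒮 × 𝒮 => E w.1 * E w.2 :=
    (hE.comp measurable_fst).mul (hE.comp measurable_snd)
  have hpt : ∀ z : Fin N → 𝒮 × 𝒮,
      ENNReal.ofReal (Real.exp (∑ n, (β * dd (z n).1 ^ 2 + β * dd (z n).2 ^ 2)))
      = ∏ n, (E (z n).1 * E (z n).2) := by
    intro z
    rw [Real.exp_sum, ENNReal.ofReal_prod_of_nonneg fun _ _ => (Real.exp_pos _).le, hEdef]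
    refine Finset.prod_congr rfl fun n _ => ?_
    rw [Real.exp_add, ENNReal.ofReal_mul (Real.exp_pos _).le]
  rw [lintegral_congr hpt, lintegral_pi_prod_eq_pow (P.prod P) hEE,
    lintegral_prod_mul hE.aemeasurable hE.aemeasurable]
  have e2 : ∫⁻ s, E s ∂P ≤ ENNReal.ofReal (Real.exp (β * K ^ 2)) := by
    rw [hEdef]
    exact lintegral_exp_mul_sq_le P hK0 hβ hβK hK
  refine (pow_le_pow_left' (mul_le_mul' e2 e2) N).trans (le_of_eq ?_)
  rw [← ENNReal.ofReal_mul (Real.exp_pos _).le, ← Real.exp_add,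
    ← ENNReal.ofReal_pow (Real.exp_pos _).le, ← Real.exp_nat_mul]
  ring_nf

variable [Nonempty ι]

/-- For a fixed sample and a maximizing index, the mean is an integral over the ghost sample; Jensen
moves it outside the exponential. -/
lemma lintegral_exp_iSup_le_symm (h : ι → 𝒮 → ℝ) (hm : ∀ i, Measurable (h i))
    (hint : ∀ i, Integrable (h i) P) {τ : ℝ} (hτ : 0 ≤ τ) :
    ∫⁻ s, ENNReal.ofReal (Real.exp (τ * ⨆ i, ∑ n : Fin N, (∫ x, h i x ∂P - h i (s n))))
        ∂(Measure.pi fun _ : Fin N => P)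
      ≤ ∫⁻ z, ENNReal.ofReal (Real.exp (τ * ⨆ i, ∑ n : Fin N, (h i (z n).2 - h i (z n).1)))
        ∂(Measure.pi fun _ : Fin N => P.prod P) := by
  have hmp := measurePreserving_arrowProdEquivProdArrow 𝒮 𝒮 (Fin N) (fun _ => P) (fun _ => P)
  let Φ : (Fin N → 𝒮) × (Fin N → 𝒮) → ENNReal := fun w =>
    ENNReal.ofReal (Real.exp (τ * ⨆ i, ∑ n : Fin N, (h i (w.2 n) - h i (w.1 n))))
  have hΦ : Measurable Φ := by
    refine Measurable.ennreal_ofReal (Real.measurable_exp.comp (Measurable.const_mul ?_ τ))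
    refine Measurable.iSup fun i => ?_
    refine Finset.measurable_fun_sum _ fun n _ => ?_
    exact ((hm i).comp (by fun_prop)).sub ((hm i).comp (by fun_prop))
  have hR : ∫⁻ z, ENNReal.ofReal (Real.exp (τ * ⨆ i, ∑ n : Fin N, (h i (z n).2 - h i (z n).1)))
        ∂(Measure.pi fun _ : Fin N => P.prod P)
      = ∫⁻ s, ∫⁻ s', Φ (s, s') ∂(Measure.pi fun _ : Fin N => P) ∂(Measure.pi fun _ : Fin N => P) := by
    rw [← lintegral_prod _ hΦ.aemeasurable, ← hmp.lintegral_comp hΦ]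
    rfl
  rw [hR]
  refine lintegral_mono fun s => ?_
  obtain ⟨i, hi⟩ := exists_eq_ciSup_of_finite
    (f := fun i => ∑ n : Fin N, (∫ x, h i x ∂P - h i (s n)))
  have hev : ∀ n : Fin N, Integrable (fun s' : Fin N → 𝒮 => h i (s' n))
      (Measure.pi fun _ : Fin N => P) := fun n =>
    (measurePreserving_eval (fun _ : Fin N => P) n).integrable_comp_of_integrable (hint i)
  have hev2 : ∀ n : Fin N, ∫ s' : Fin N → 𝒮, h i (s' n) ∂(Measure.pi fun _ : Fin N => P)
      = ∫ x, h i x ∂P := by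
    intro n
    have hme := measurePreserving_eval (fun _ : Fin N => P) n
    have := integral_map (f := h i) (μ := Measure.pi fun _ : Fin N => P) hme.measurable.aemeasurable (hm i).aestronglyMeasurable
    rw [hme.map_eq] at this
    exact this.symm
  have hY : Integrable (fun s' : Fin N → 𝒮 => τ * ∑ n, (h i (s' n) - h i (s n)))
      (Measure.pi fun _ : Fin N => P) :=
    (integrable_finsetSum _ fun n _ => (hev n).sub (integrable_const _)).const_mul τ
  have hval : ∫ s' : Fin N → 𝒮, τ * ∑ n, (h i (s' n) - h i (s n)) ∂(Measure.pi fun _ : Fin N => P)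
      = τ * ∑ n : Fin N, (∫ x, h i x ∂P - h i (s n)) := by
    rw [integral_const_mul, integral_finsetSum (f := fun n (s' : Fin N → 𝒮) => h i (s' n) - h i (s n)) _
      fun n _ => (hev n).sub (integrable_const _)]
    congr 1
    refine Finset.sum_congr rfl fun n _ => ?_
    rw [integral_sub (hev n) (integrable_const _), hev2]
    simp
  have hJ := exp_lintegral_le (Measure.pi fun _ : Fin N => P) hY
  rw [hval, hi] at hJ
  refine hJ.trans (lintegral_mono fun s' => ENNReal.ofReal_le_ofReal (Real.exp_le_exp.2 ?_))
  exact mul_le_mul_of_nonneg_left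
    (le_iSup_fin (fun i => ∑ n : Fin N, (h i (s' n) - h i (s n))) i) hτ

lemma lintegral_exp_iSup_symm_le (θ : ι → Fin D → ℝ) (hθ : ∀ i, sqLen (θ i) ≤ 1)
    (h : ι → 𝒮 → ℝ) (hm : ∀ i, Measurable (h i)) (dd : 𝒮 → ℝ) (hdm : Measurable dd)
    (hL : ∀ s i j, h i s - h j s ≤ dd s * √(sqLen (θ i - θ j)))
    (h0 : ∀ i s, 0 ≤ h i s) (h2 : ∀ i s, h i s ≤ 2 * dd s)
    {K : ℝ} (hK0 : 0 < K) (hK : ∫⁻ s, ENNReal.ofReal (Real.exp (dd s ^ 2 / K ^ 2)) ∂P ≤ 2)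
    {τ : ℝ} (hτ : 0 ≤ τ) (hτK : 3 * τ ^ 2 * K ^ 2 ≤ 1) :
    ∫⁻ z, ENNReal.ofReal (Real.exp (τ * ⨆ i, ∑ n : Fin N, (h i (z n).2 - h i (z n).1)))
        ∂(Measure.pi fun _ : Fin N => P.prod P)
      ≤ ENNReal.ofReal (Real.exp (2 * D + 6 * N * τ ^ 2 * K ^ 2)) := by
  have hG : ∀ e : Fin N → ℝ, Measurable fun z : Fin N → 𝒮 × 𝒮 =>
      Real.exp (τ * ⨆ i, ∑ n : Fin N, e n * (h i (z n).2 - h i (z n).1)) := by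
    intro e
    refine Real.measurable_exp.comp (Measurable.const_mul ?_ τ)
    refine Measurable.iSup fun i => ?_
    refine Finset.measurable_fun_sum _ fun n _ => Measurable.const_mul ?_ _
    exact ((hm i).comp (by fun_prop)).sub ((hm i).comp (by fun_prop))
  rw [← lintegral_signAvg (Measure.pi fun _ : Fin N => P.prod P) _ hG
    (fun e z => (Real.exp_pos _).le) _ fun e he => lintegral_exp_iSup_sign_flip P h hm τ e he]
  calc _ ≤ ∫⁻ z : Fin N → 𝒮 × 𝒮, ENNReal.ofReal (Real.exp (2 * D))
        * ENNReal.ofReal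
          (Real.exp (∑ n, (3 * τ ^ 2 * dd (z n).1 ^ 2 + 3 * τ ^ 2 * dd (z n).2 ^ 2)))
        ∂(Measure.pi fun _ : Fin N => P.prod P) := by
        refine lintegral_mono fun z => ?_
        rw [← ENNReal.ofReal_mul (Real.exp_pos _).le, ← Real.exp_add]
        exact ENNReal.ofReal_le_ofReal (signAvg_exp_iSup_diff_le θ hθ h dd hL h0 h2 hτ z)
    _ ≤ ENNReal.ofReal (Real.exp (2 * D))
        * ENNReal.ofReal (Real.exp (2 * N * (3 * τ ^ 2) * K ^ 2)) := by
        rw [lintegral_const_mul' _ _ ENNReal.ofReal_ne_top]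
        gcongr
        exact lintegral_exp_sum_sq_le P dd hdm hK0 hK (by positivity) hτK
    _ = _ := by
        rw [← ENNReal.ofReal_mul (Real.exp_pos _).le, ← Real.exp_add]
        ring_nf

end Symmetrization

/-- From `|X| ≤ K / 2 * (X² / K² + 1) ≤ K / 2 * exp (X² / K²)`. -/
lemma integrable_of_exp_sq {𝒮 : Type*} [MeasurableSpace 𝒮] (P : Measure 𝒮) [IsProbabilityMeasure P]
    {X : 𝒮 → ℝ} (hX : AEMeasurable X P) {K : ℝ} (hK0 : 0 < K)
    (hK : ∫⁻ s, ENNReal.ofReal (Real.exp (X s ^ 2 / K ^ 2)) ∂P ≤ 2) :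
    Integrable X P ∧ ∫ s, X s ∂P ≤ K := by
  have h0 : 0 ≤ᵐ[P] fun s => Real.exp (X s ^ 2 / K ^ 2) :=
    Filter.Eventually.of_forall fun s => (Real.exp_pos _).le
  have hexp : Integrable (fun s => Real.exp (X s ^ 2 / K ^ 2)) P := by
    refine ⟨(Real.measurable_exp.comp_aemeasurable
      ((hX.pow_const 2).div_const _)).aestronglyMeasurable, ?_⟩
    rw [hasFiniteIntegral_iff_ofReal h0]
    exact hK.trans_lt ENNReal.ofNat_lt_top
  have hval : ∫ s, Real.exp (X s ^ 2 / K ^ 2) ∂P ≤ 2 := by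
    rw [integral_eq_lintegral_of_nonneg_ae h0 hexp.1]
    exact ENNReal.toReal_le_of_le_ofReal (by norm_num) (by simpa using hK)
  have hpt : ∀ s, |X s| ≤ K / 2 * Real.exp (X s ^ 2 / K ^ 2) := by
    intro s
    have h1 := Real.add_one_le_exp (X s ^ 2 / K ^ 2)
    have h2 : |X s| ≤ K / 2 * (X s ^ 2 / K ^ 2 + 1) := by
      have : K / 2 * (X s ^ 2 / K ^ 2 + 1) - |X s| = (|X s| - K) ^ 2 / (2 * K) := by
        rw [sub_sq, sq_abs]
        field_simp
        ring
      have : 0 ≤ (|X s| - K) ^ 2 / (2 * K) := by positivity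
      linarith
    exact h2.trans (by gcongr)
  have hint : Integrable X P :=
    (hexp.const_mul (K / 2)).mono' hX.aestronglyMeasurable (Filter.Eventually.of_forall hpt)
  refine ⟨hint, ?_⟩
  calc ∫ s, X s ∂P ≤ ∫ s, K / 2 * Real.exp (X s ^ 2 / K ^ 2) ∂P :=
        integral_mono hint (hexp.const_mul _) fun s => (le_abs_self _).trans (hpt s)
    _ ≤ K := by
        rw [integral_const_mul]
        nlinarith

/-! ### Uniform deviation over finite and countable families -/

section Tail

variable {𝒮 : Type*} [MeasurableSpace 𝒮] (P : Measure 𝒮) [IsProbabilityMeasure P] {D N : ℕ}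

lemma measure_pi_exists_gap_le {ι : Type*} [Finite ι] [Nonempty ι] (hN : 0 < N)
    (θ : ι → Fin D → ℝ) (hθ : ∀ i, sqLen (θ i) ≤ 1)
    (h : ι → 𝒮 → ℝ) (hm : ∀ i, Measurable (h i)) (dd : 𝒮 → ℝ) (hdm : Measurable dd)
    (hL : ∀ s i j, h i s - h j s ≤ dd s * √(sqLen (θ i - θ j)))
    (h0 : ∀ i s, 0 ≤ h i s) (h2 : ∀ i s, h i s ≤ 2 * dd s)
    {K : ℝ} (hK0 : 0 < K) (hK : ∫⁻ s, ENNReal.ofReal (Real.exp (dd s ^ 2 / K ^ 2)) ∂P ≤ 2)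
    {b : ℝ} (hb : 0 ≤ b) :
    (Measure.pi fun _ : Fin N => P)
        {s | ∃ i, K * b * √N < ∑ n : Fin N, (∫ x, h i x ∂P - h i (s n))}
      ≤ ENNReal.ofReal (Real.exp (-b ^ 2 / 24 + 2 * D)) := by
  obtain ⟨hdint, hdK⟩ := integrable_of_exp_sq P hdm.aemeasurable hK0 hK
  have hint : ∀ i, Integrable (h i) P := fun i =>
    (hdint.const_mul 2).mono' (hm i).aestronglyMeasurable
      (Filter.Eventually.of_forall fun s => by
        rw [Real.norm_eq_abs, abs_of_nonneg (h0 i s)]; exact h2 i s)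
  have hNR : (0 : ℝ) < N := Nat.cast_pos.2 hN
  have hsN : 0 < √(N : ℝ) := Real.sqrt_pos.2 hNR
  have hsN2 : √(N : ℝ) ^ 2 = N := Real.sq_sqrt hNR.le
  by_cases hbN : b ^ 2 ≤ 48 * N
  -- This `τ` minimizes `6 * N * τ² * K² - τ * K * b * √N`, with value `-b² / 24`. The case
  -- condition on `b` is exactly the admissibility `3 * τ² * K² ≤ 1`.
  · set τ := b / (12 * K * √N) with hτdef
    have hτ : 0 ≤ τ := by positivity
    have hτ2 : τ ^ 2 * K ^ 2 = b ^ 2 / (144 * N) := by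
      rw [hτdef, div_pow, mul_pow, hsN2]
      field_simp
      ring
    have hτK : 3 * τ ^ 2 * K ^ 2 ≤ 1 := by
      rw [mul_assoc, hτ2, ← mul_div_assoc, div_le_one (by positivity)]
      linarith
    have hτb : τ * (K * b * √N) = b ^ 2 / 12 := by
      rw [hτdef]
      field_simp
    have hexpo : 6 * N * τ ^ 2 * K ^ 2 = b ^ 2 / 24 := by
      rw [mul_assoc, hτ2]
      field_simp
      ring
    have hbound := (lintegral_exp_iSup_le_symm (N := N) P h hm hint hτ).trans
      (lintegral_exp_iSup_symm_le P θ hθ h hm dd hdm hL h0 h2 hK0 hK hτ hτK)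
    have hmeas : Measurable fun s : Fin N → 𝒮 => ENNReal.ofReal
        (Real.exp (τ * ⨆ i, ∑ n : Fin N, (∫ x, h i x ∂P - h i (s n)))) := by
      refine (Real.measurable_exp.comp (Measurable.const_mul ?_ τ)).ennreal_ofReal
      refine Measurable.iSup fun i => Finset.measurable_fun_sum _ fun n _ => ?_
      exact measurable_const.sub ((hm i).comp (measurable_pi_apply n))
    have hsub : {s : Fin N → 𝒮 | ∃ i, K * b * √N < ∑ n : Fin N, (∫ x, h i x ∂P - h i (s n))}
        ⊆ {s | ENNReal.ofReal (Real.exp (b ^ 2 / 12)) ≤ ENNReal.ofReal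
          (Real.exp (τ * ⨆ i, ∑ n : Fin N, (∫ x, h i x ∂P - h i (s n))))} := by
      rintro s ⟨i, hi⟩
      refine ENNReal.ofReal_le_ofReal (Real.exp_le_exp.2 ?_)
      rw [← hτb]
      exact mul_le_mul_of_nonneg_left
        (hi.le.trans (le_iSup_fin (fun i => ∑ n : Fin N, (∫ x, h i x ∂P - h i (s n))) i)) hτ
    refine (measure_mono hsub).trans ((meas_ge_le_lintegral_div hmeas.aemeasurable ?_
      ENNReal.ofReal_ne_top).trans (ENNReal.div_le_of_le_mul (hbound.trans (le_of_eq ?_))))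
    · exact (ENNReal.ofReal_pos.2 (Real.exp_pos _)).ne'
    · rw [← ENNReal.ofReal_mul (Real.exp_pos _).le, ← Real.exp_add, hexpo]
      congr 2
      ring
  -- For larger `b` the event is empty: each summand is at most the mean, hence at most `2 * K`,
  -- which would force `b² < 4 * N`.
  · have hempty : {s : Fin N → 𝒮 | ∃ i, K * b * √N < ∑ n : Fin N, (∫ x, h i x ∂P - h i (s n))}
        = ∅ := by
      refine Set.eq_empty_of_forall_notMem ?_
      rintro s ⟨i, hi⟩
      have h1 : ∫ x, h i x ∂P ≤ 2 * K := by
        refine (integral_mono (hint i) (hdint.const_mul 2) (h2 i)).trans ?_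
        rw [integral_const_mul]
        linarith
      have hle : ∑ n : Fin N, (∫ x, h i x ∂P - h i (s n)) ≤ N * (2 * K) := by
        refine (Finset.sum_le_card_nsmul _ _ (2 * K) fun n _ => ?_).trans (by simp)
        linarith [h0 i (s n)]
      have hb2 : b * √N < 2 * N := by
        refine lt_of_mul_lt_mul_left ?_ hK0.le
        linarith
      have hb3 : b < 2 * √N := by
        refine lt_of_mul_lt_mul_right ?_ hsN.le
        rw [mul_assoc, ← pow_two, hsN2]
        exact hb2
      have : b ^ 2 < 4 * N := by
        calc b ^ 2 < (2 * √(N : ℝ)) ^ 2 := by gcongr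
          _ = _ := by rw [mul_pow, hsN2]; norm_num
      exact hbN (by linarith)
    rw [hempty, measure_empty]
    exact zero_le

lemma measure_pi_exists_gap_le_of_aemeasurable {ι : Type*} [Finite ι] [Nonempty ι] (hN : 0 < N)
    (θ : ι → Fin D → ℝ) (hθ : ∀ i, sqLen (θ i) ≤ 1)
    (h : ι → 𝒮 → ℝ) (hm : ∀ i, AEMeasurable (h i) P) (dd : 𝒮 → ℝ) (hdm : AEMeasurable dd P)
    (hL : ∀ s i j, h i s - h j s ≤ dd s * √(sqLen (θ i - θ j)))
    (h0 : ∀ i s, 0 ≤ h i s) (h2 : ∀ i s, h i s ≤ 2 * dd s)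
    {K : ℝ} (hK0 : 0 < K) (hK : ∫⁻ s, ENNReal.ofReal (Real.exp (dd s ^ 2 / K ^ 2)) ∂P ≤ 2)
    {b : ℝ} (hb : 0 ≤ b) :
    (Measure.pi fun _ : Fin N => P)
        {s | ∃ i, K * b * √N < ∑ n : Fin N, (∫ x, h i x ∂P - h i (s n))}
      ≤ ENNReal.ofReal (Real.exp (-b ^ 2 / 24 + 2 * D)) := by
  have hae : ∀ᵐ s ∂P, (∀ i, h i s = (hm i).mk _ s) ∧ dd s = hdm.mk _ s :=
    (ae_all_iff.2 fun i => (hm i).ae_eq_mk).and hdm.ae_eq_mk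
  -- The Lipschitz and range inequalities are needed at every point, and measurable representatives
  -- may break them. Cutting off by the indicator of a measurable full set `G` of agreement
  -- preserves them.
  obtain ⟨G, hG, hGm, hGae⟩ := (Filter.eventually_iff.1 hae |> fun hmem =>
    (mem_ae_iff.1 hmem |> fun hz => ⟨(toMeasurable P _)ᶜ,
      Set.compl_subset_comm.1 (subset_toMeasurable P _), (measurableSet_toMeasurable _ _).compl, by
        rw [mem_ae_iff, compl_compl, measure_toMeasurable]; exact hz⟩ :
    ∃ G ⊆ {s | (∀ i, h i s = (hm i).mk _ s) ∧ dd s = hdm.mk _ s}, MeasurableSet G ∧ G ∈ ae P))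
  have hh : ∀ i, G.indicator ((hm i).mk _) = G.indicator (h i) := fun i =>
    Set.indicator_congr fun s hs => ((hG hs).1 i).symm
  have hd : G.indicator (hdm.mk _) = G.indicator dd :=
    Set.indicator_congr fun s hs => (hG hs).2.symm
  have hind : ∀ (u : 𝒮 → ℝ), G.indicator u =ᵐ[P] u := fun u => by
    filter_upwards [hGae] with s hs using Set.indicator_of_mem hs u
  have key := measure_pi_exists_gap_le P hN θ hθ (fun i => G.indicator (h i))
    (fun i => by rw [← hh]; exact (hm i).measurable_mk.indicator hGm)
    (G.indicator dd) (by rw [← hd]; exact hdm.measurable_mk.indicator hGm)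
    (fun s i j => by
      by_cases hs : s ∈ G
      · simpa [hs] using hL s i j
      · simp [hs])
    (fun i s => Set.indicator_nonneg (fun s _ => h0 i s) s)
    (fun i s => by
      by_cases hs : s ∈ G
      · simpa [hs] using h2 i s
      · simp [hs]) hK0
    (by
      refine le_trans (le_of_eq (lintegral_congr_ae ?_)) hK
      filter_upwards [hind dd] with s hs
      rw [hs]) hb
  refine le_trans (measure_mono_ae ?_) key
  have hall : ∀ᵐ s ∂(Measure.pi fun _ : Fin N => P), ∀ n, s n ∈ G :=
    ae_all_iff.2 fun n =>
      (measurePreserving_eval (fun _ : Fin N => P) n).quasiMeasurePreserving.ae hGae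
  filter_upwards [hall] with s hs
  rintro ⟨i, hi⟩
  refine ⟨i, ?_⟩
  simpa [integral_congr_ae (hind (h i)), hs] using hi

/-- The uniform deviation bound over a countable family of parameters. -/
lemma measure_pi_exists_nat_gap_le (hN : 0 < N)
    (θ : ℕ → Fin D → ℝ) (hθ : ∀ i, sqLen (θ i) ≤ 1)
    (h : ℕ → 𝒮 → ℝ) (hm : ∀ i, AEMeasurable (h i) P) (dd : 𝒮 → ℝ) (hdm : AEMeasurable dd P)
    (hL : ∀ s i j, h i s - h j s ≤ dd s * √(sqLen (θ i - θ j)))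
    (h0 : ∀ i s, 0 ≤ h i s) (h2 : ∀ i s, h i s ≤ 2 * dd s)
    {K : ℝ} (hK0 : 0 < K) (hK : ∫⁻ s, ENNReal.ofReal (Real.exp (dd s ^ 2 / K ^ 2)) ∂P ≤ 2)
    {b : ℝ} (hb : 0 ≤ b) :
    (Measure.pi fun _ : Fin N => P)
        {s | ∃ i, K * b * √N < ∑ n : Fin N, (∫ x, h i x ∂P - h i (s n))}
      ≤ ENNReal.ofReal (Real.exp (-b ^ 2 / 24 + 2 * D)) := by
  let A : ℕ → Set (Fin N → 𝒮) := fun m =>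
    {s | ∃ i : Fin (m + 1), K * b * √N < ∑ n : Fin N, (∫ x, h i x ∂P - h i (s n))}
  have hA : {s : Fin N → 𝒮 | ∃ i, K * b * √N < ∑ n : Fin N, (∫ x, h i x ∂P - h i (s n))}
      ⊆ ⋃ m, A m := by
    rintro s ⟨i, hi⟩
    exact Set.mem_iUnion.2 ⟨i, Fin.last i, by simpa using hi⟩
  have hmono : Monotone A := by
    intro m m' hmm s
    rintro ⟨i, hi⟩
    exact ⟨Fin.castLE (by omega) i, by simpa using hi⟩
  refine (measure_mono hA).trans ?_
  rw [hmono.measure_iUnion]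
  exact iSup_le fun m => measure_pi_exists_gap_le_of_aemeasurable P hN (fun i : Fin (m + 1) => θ i)
    (fun i => hθ i) (fun i => h i) (fun i => hm i) dd hdm (fun s i j => hL s i j)
    (fun i => h0 i) (fun i => h2 i) hK0 hK hb

end Tail

/-! ### The sub-Gaussian norm -/

section Norm

variable {𝒮 : Type*} [MeasurableSpace 𝒮] (P : Measure 𝒮)

lemma psi2Norm_nonneg (X : 𝒮 → ℝ) : 0 ≤ psi2Norm P X :=
  Real.sInf_nonneg fun _ ht => ht.1.le

lemma bddBelow_psi2Set (X : 𝒮 → ℝ) : BddBelow (psi2Set P X) :=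
  ⟨0, fun _ ht => ht.1.le⟩

/-- A positive sub-Gaussian norm is attained. -/
lemma lintegral_exp_psi2Norm_le {X : 𝒮 → ℝ} (hX : AEMeasurable X P) (hsub : IsSubGaussian P X)
    (hpos : 0 < psi2Norm P X) :
    ∫⁻ s, ENNReal.ofReal (Real.exp (X s ^ 2 / psi2Norm P X ^ 2)) ∂P ≤ 2 := by
  obtain ⟨t, -, ht, htm⟩ := exists_seq_tendsto_sInf hsub (bddBelow_psi2Set P X)
  have hlim : ∀ s, Filter.Tendsto (fun n => ENNReal.ofReal (Real.exp (X s ^ 2 / t n ^ 2)))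
      Filter.atTop (nhds (ENNReal.ofReal (Real.exp (X s ^ 2 / psi2Norm P X ^ 2)))) := fun s =>
    ENNReal.tendsto_ofReal ((Real.continuous_exp.tendsto _).comp
      (tendsto_const_nhds.div (ht.pow 2) (by positivity)))
  rw [lintegral_congr fun s => (hlim s).liminf_eq.symm]
  -- Fatou's lemma along a sequence in `psi2Set` converging to its infimum.
  refine (lintegral_liminf_le' fun n => (Real.measurable_exp.comp_aemeasurable
    ((hX.pow_const 2).div_const _)).ennreal_ofReal).trans ?_
  exact Filter.liminf_le_of_frequently_le' (Filter.Frequently.of_forall fun n => (htm n).2)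

lemma ae_eq_zero_of_psi2Norm_eq_zero [IsProbabilityMeasure P] {X : 𝒮 → ℝ} (hX : AEMeasurable X P)
    (h0 : ∀ s, 0 ≤ X s) (hsub : IsSubGaussian P X) (hzero : psi2Norm P X = 0) : X =ᵐ[P] 0 := by
  obtain ⟨t, ht⟩ := hsub
  have hint := (integrable_of_exp_sq P hX ht.1 ht.2).1
  rw [← integral_eq_zero_iff_of_nonneg h0 hint]
  refine le_antisymm ?_ (integral_nonneg h0)
  rw [← hzero]
  exact le_csInf ⟨t, ht⟩ fun r hr => (integrable_of_exp_sq P hX hr.1 hr.2).2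

lemma psi2Norm_zero [IsProbabilityMeasure P] : psi2Norm P (fun _ => 0) = 0 := by
  refine le_antisymm (le_of_forall_pos_le_add fun ε hε => ?_) (psi2Norm_nonneg P _)
  rw [zero_add]
  refine csInf_le (bddBelow_psi2Set P _) ⟨hε, ?_⟩
  simp

end Norm

/-! ### Size of the probability simplex -/

section Simplex

variable {D : ℕ}

lemma sqLen_le_one_of_mem_stdSimplex {θ : Fin D → ℝ} (hθ : θ ∈ stdSimplex ℝ (Fin D)) :
    sqLen θ ≤ 1 := by
  rw [← hθ.2]
  refine Finset.sum_le_sum fun i _ => ?_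
  have h1 : θ i ≤ 1 := by
    rw [← hθ.2]
    exact Finset.single_le_sum (fun j _ => hθ.1 j) (Finset.mem_univ i)
  nlinarith [hθ.1 i]

lemma sqrt_sqLen_sub_le_two {θ θ' : Fin D → ℝ} (hθ : θ ∈ stdSimplex ℝ (Fin D))
    (hθ' : θ' ∈ stdSimplex ℝ (Fin D)) : √(sqLen (θ - θ')) ≤ 2 := by
  have h1 := sqLen_le_one_of_mem_stdSimplex hθ
  have h2 := sqLen_le_one_of_mem_stdSimplex hθ'
  have h3 : sqLen (θ - θ') ≤ sqLen θ + sqLen θ' := by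
    simp only [sqLen, ← Finset.sum_add_distrib, Pi.sub_apply]
    exact Finset.sum_le_sum fun i _ => by nlinarith [mul_nonneg (hθ.1 i) (hθ'.1 i)]
  exact Real.sqrt_le_iff.2 ⟨by norm_num, by linarith⟩

lemma continuous_sqLen : Continuous (sqLen : (Fin D → ℝ) → ℝ) := by
  unfold sqLen
  fun_prop

end Simplex

/-! ### Uniform deviation over the whole simplex -/

section Tail

variable {𝒮 : Type*} [MeasurableSpace 𝒮] (P : Measure 𝒮) [IsProbabilityMeasure P] {D N : ℕ}

/-- The uniform deviation bound over the parameters without empirical loss. -/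
lemma measure_pi_exists_simplex_gap_le (hN : 0 < N) (hne : (stdSimplex ℝ (Fin D)).Nonempty)
    (h : (Fin D → ℝ) → 𝒮 → ℝ) (hm : ∀ θ ∈ stdSimplex ℝ (Fin D), AEMeasurable (h θ) P)
    (dd : 𝒮 → ℝ) (hdm : AEMeasurable dd P)
    (hL : ∀ s, ∀ θ ∈ stdSimplex ℝ (Fin D), ∀ θ' ∈ stdSimplex ℝ (Fin D),
      h θ s - h θ' s ≤ dd s * √(sqLen (θ - θ')))
    (h0 : ∀ θ ∈ stdSimplex ℝ (Fin D), ∀ s, 0 ≤ h θ s)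
    (h2 : ∀ θ ∈ stdSimplex ℝ (Fin D), ∀ s, h θ s ≤ 2 * dd s)
    {K : ℝ} (hK0 : 0 < K) (hK : ∫⁻ s, ENNReal.ofReal (Real.exp (dd s ^ 2 / K ^ 2)) ∂P ≤ 2)
    {b : ℝ} (hb : 0 ≤ b) :
    (Measure.pi fun _ : Fin N => P)
        {s | ∃ θ ∈ stdSimplex ℝ (Fin D), ∑ n, h θ (s n) = 0 ∧ K * b / √N < ∫ x, h θ x ∂P}
      ≤ ENNReal.ofReal (Real.exp (-b ^ 2 / 24 + 2 * D)) := by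
  have : Nonempty (stdSimplex ℝ (Fin D)) := hne.to_subtype
  set q : ℕ → stdSimplex ℝ (Fin D) := TopologicalSpace.denseSeq _
  obtain ⟨hdint, -⟩ := integrable_of_exp_sq P hdm hK0 hK
  have hint : ∀ θ ∈ stdSimplex ℝ (Fin D), Integrable (h θ) P := fun θ hθ =>
    (hdint.const_mul 2).mono' (hm θ hθ).aestronglyMeasurable
      (Filter.Eventually.of_forall fun s => by
        rw [Real.norm_eq_abs, abs_of_nonneg (h0 θ hθ s)]; exact h2 θ hθ s)
  have hNR : (0 : ℝ) < N := Nat.cast_pos.2 hN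
  have hsN : 0 < √(N : ℝ) := Real.sqrt_pos.2 hNR
  refine le_trans (measure_mono ?_) (measure_pi_exists_nat_gap_le P hN (fun i => (q i).1)
    (fun i => sqLen_le_one_of_mem_stdSimplex (q i).2) (fun i => h (q i).1) (fun i => hm _ (q i).2)
    dd hdm (fun s i j => hL s _ (q i).2 _ (q j).2) (fun i => h0 _ (q i).2)
    (fun i => h2 _ (q i).2) hK0 hK hb)
  rintro s ⟨θ, hθ, hzero, hgap⟩
  let F : stdSimplex ℝ (Fin D) → ℝ := fun t =>
    ∑ n : Fin N, (∫ x, h t.1 x ∂P - h t.1 (s n))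
  have hcont : Continuous F := by
    have hdist : ∀ u : stdSimplex ℝ (Fin D) → ℝ, ∀ c : ℝ,
        (∀ t t' : stdSimplex ℝ (Fin D), u t - u t' ≤ c * √(sqLen (t.1 - t'.1))) →
        Continuous u := by
      intro u c hu
      rw [continuous_iff_continuousAt]
      intro t
      rw [ContinuousAt, tendsto_iff_norm_sub_tendsto_zero]
      have hc : Continuous fun t' : stdSimplex ℝ (Fin D) =>
          c * √(sqLen (t'.1 - t.1)) :=
        continuous_const.mul (Real.continuous_sqrt.comp (continuous_sqLen.comp (by fun_prop)))
      have hlim := hc.tendsto t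
      simp only [sub_self] at hlim
      have hz : sqLen (0 : Fin D → ℝ) = 0 := by simp [sqLen]
      rw [hz, Real.sqrt_zero, mul_zero] at hlim
      refine squeeze_zero (fun _ => norm_nonneg _) (fun t' => ?_) hlim
      rw [Real.norm_eq_abs, abs_le]
      have e1 := hu t' t
      have e2 := hu t t'
      have e3 : sqLen (t.1 - t'.1) = sqLen (t'.1 - t.1) := by
        simp only [sqLen, Pi.sub_apply]
        exact Finset.sum_congr rfl fun k _ => by ring
      rw [e3] at e2
      constructor <;> linarith
    refine continuous_finsetSum _ fun n _ => Continuous.sub ?_ ?_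
    · refine hdist _ (∫ x, dd x ∂P) fun t t' => ?_
      rw [← integral_sub (hint _ t.2) (hint _ t'.2), ← integral_mul_const]
      exact integral_mono ((hint _ t.2).sub (hint _ t'.2)) (hdint.mul_const _)
        fun x => hL x _ t.2 _ t'.2
    · exact hdist _ (dd (s n)) fun t t' => hL _ _ t.2 _ t'.2
  -- The gap is continuous in the parameter and the inequality strict, so a violation at `θ`
  -- persists at a point of the dense sequence. The empirical loss there need not vanish, which is
  -- why the countable bound concerns the full gap.
  have hopen : IsOpen {t | K * b * √N < F t} := isOpen_lt continuous_const hcont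
  have hmem : (⟨θ, hθ⟩ : stdSimplex ℝ (Fin D)) ∈ {t | K * b * √N < F t} := by
    have hF : F ⟨θ, hθ⟩ = N * ∫ x, h θ x ∂P := by
      simp only [F, Finset.sum_sub_distrib]
      rw [hzero]
      simp
    rw [Set.mem_ofPred_eq, hF]
    rw [div_lt_iff₀ hsN] at hgap
    calc K * b * √N < (∫ x, h θ x ∂P) * √N * √N := by gcongr
      _ = _ := by rw [mul_assoc, Real.mul_self_sqrt hNR.le, mul_comm]
  obtain ⟨i, hi⟩ := (TopologicalSpace.denseRange_denseSeq
    (stdSimplex ℝ (Fin D))).exists_mem_open hopen ⟨_, hmem⟩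
  exact ⟨i, hi⟩

end Tail

/-! ### Lipschitz dependence of the loss and monotonicity of the feasible sets -/

section Loss

variable {𝒮 : Type*} {k D d J : ℕ} {𝒳 : Set (EuclideanSpace ℝ (Fin k))}
  {f : EuclideanSpace ℝ (Fin k) → 𝒮 → EuclideanSpace ℝ (Fin D)}
  {g : EuclideanSpace ℝ (Fin k) → (Fin d → ℝ) → 𝒮 → (Fin J → ℝ)}

lemma suboptLoss_eq_of_mem_feasible {x : EuclideanSpace ℝ (Fin k)} {φ : Fin d → ℝ} {s : 𝒮}
    (hx : x ∈ feasible 𝒳 g φ s) (lam : ℝ) (θ : Fin D → ℝ) :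
    suboptLoss 𝒳 f g lam x θ φ s = suboptLoss 𝒳 f g 0 x θ φ s := by
  have : ∑ j, max (g x φ s j) 0 = 0 :=
    Finset.sum_eq_zero fun j _ => max_eq_right (hx.2 j)
  simp [suboptLoss, this]

lemma suboptLoss_congr_feasible {φ φ' : Fin d → ℝ} {s : 𝒮}
    (h : feasible 𝒳 g φ s = feasible 𝒳 g φ' s) (x : EuclideanSpace ℝ (Fin k)) (θ : Fin D → ℝ) :
    suboptLoss 𝒳 f g 0 x θ φ s = suboptLoss 𝒳 f g 0 x θ φ' s := by
  simp [suboptLoss, h]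

lemma suboptLoss_nonneg (x : EuclideanSpace ℝ (Fin k)) (θ : Fin D → ℝ) (φ : Fin d → ℝ) (s : 𝒮) :
    0 ≤ suboptLoss 𝒳 f g 0 x θ φ s := by
  simp [suboptLoss]

lemma suboptLoss_eq_zero {x : EuclideanSpace ℝ (Fin k)} {θ : Fin D → ℝ} {φ : Fin d → ℝ} {s : 𝒮}
    (hx : x ∈ FOP 𝒳 f g θ φ s) : suboptLoss 𝒳 f g 0 x θ φ s = 0 := by
  have : sSup ((fun y => objective f θ y s) '' feasible 𝒳 g φ s) ≤ objective f θ x s := by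
    refine csSup_le ⟨_, x, hx.1, rfl⟩ ?_
    rintro _ ⟨y, hy, rfl⟩
    exact hx.2 y hy
  simp [suboptLoss, this]

lemma objective_sub_le (θ θ' : Fin D → ℝ) (x y : EuclideanSpace ℝ (Fin k)) (s : 𝒮) :
    (objective f θ y s - objective f θ x s) - (objective f θ' y s - objective f θ' x s)
      ≤ ‖f y s - f x s‖ * √(sqLen (θ - θ')) := by
  have h1 : (objective f θ y s - objective f θ x s) - (objective f θ' y s - objective f θ' x s)
      = ∑ i, (f y s - f x s) i * (θ - θ') i := by
    simp only [objective, ← Finset.sum_sub_distrib, PiLp.sub_apply, Pi.sub_apply]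
    exact Finset.sum_congr rfl fun i _ => by ring
  rw [h1]
  refine (Real.sum_mul_le_sqrt_mul_sqrt _ _ _).trans (le_of_eq ?_)
  rw [EuclideanSpace.norm_eq]
  simp [sqLen]

lemma suboptLoss_sub_le {x : EuclideanSpace ℝ (Fin k)} {φ : Fin d → ℝ} {s : 𝒮} {R : ℝ}
    (hx : x ∈ feasible 𝒳 g φ s) (hR : ∀ y ∈ feasible 𝒳 g φ s, ‖f y s - f x s‖ ≤ R)
    (θ θ' : Fin D → ℝ) :
    suboptLoss 𝒳 f g 0 x θ φ s - suboptLoss 𝒳 f g 0 x θ' φ s ≤ R * √(sqLen (θ - θ')) := by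
  have hpt : ∀ (θ θ' : Fin D → ℝ), ∀ y ∈ feasible 𝒳 g φ s,
      objective f θ y s ≤ objective f θ x s + (objective f θ' y s - objective f θ' x s)
        + R * √(sqLen (θ - θ')) := fun θ θ' y hy => by
    have h1 := objective_sub_le (f := f) θ θ' x y s
    have h2 := mul_le_mul_of_nonneg_right (hR y hy) (Real.sqrt_nonneg (sqLen (θ - θ')))
    linarith
  have hbdd : BddAbove ((fun y => objective f θ' y s) '' feasible 𝒳 g φ s) := by
    refine ⟨objective f θ' x s + R * √(sqLen θ'), ?_⟩
    rintro _ ⟨y, hy, rfl⟩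
    have := hpt θ' 0 y hy
    simpa [objective] using this
  have hsup : sSup ((fun y => objective f θ y s) '' feasible 𝒳 g φ s) - objective f θ x s
      ≤ (sSup ((fun y => objective f θ' y s) '' feasible 𝒳 g φ s) - objective f θ' x s)
        + R * √(sqLen (θ - θ')) := by
    have : sSup ((fun y => objective f θ y s) '' feasible 𝒳 g φ s)
        ≤ objective f θ x s + (sSup ((fun y => objective f θ' y s) '' feasible 𝒳 g φ s)
          - objective f θ' x s) + R * √(sqLen (θ - θ')) := by
      refine csSup_le ⟨_, x, hx, rfl⟩ ?_
      rintro _ ⟨y, hy, rfl⟩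
      have h1 := hpt θ θ' y hy
      have h2 := le_csSup hbdd ⟨y, hy, rfl⟩
      simp only at h2 ⊢
      linarith
    linarith
  have hR0 : 0 ≤ R * √(sqLen (θ - θ')) :=
    mul_nonneg ((norm_nonneg _).trans (hR x hx)) (Real.sqrt_nonneg _)
  simp only [suboptLoss, zero_mul, add_zero]
  rw [sub_le_iff_le_add, max_le_iff]
  constructor
  · have := le_max_left (sSup ((fun y => objective f θ' y s) '' feasible 𝒳 g φ s)
      - objective f θ' x s) 0
    linarith
  · have := le_max_right (sSup ((fun y => objective f θ' y s) '' feasible 𝒳 g φ s)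
      - objective f θ' x s) 0
    linarith

lemma norm_sub_le_feasDist {xhat : 𝒮 → EuclideanSpace ℝ (Fin k)} {φ : Fin d → ℝ} {s : 𝒮}
    (hc : IsCompact (feasible 𝒳 g φ s)) {y : EuclideanSpace ℝ (Fin k)}
    (hy : y ∈ feasible 𝒳 g φ s) : ‖y - xhat s‖ ≤ feasDist 𝒳 g xhat φ s := by
  rw [← dist_eq_norm, ← Metric.infDist_singleton]
  exact Metric.infDist_le_hausdorffDist_of_mem hy
    (Metric.hausdorffEDist_ne_top_of_nonempty_of_bounded ⟨y, hy⟩ (Set.singleton_nonempty _)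
      hc.isBounded Bornology.isBounded_singleton)

lemma feasDist_nonneg (xhat : 𝒮 → EuclideanSpace ℝ (Fin k)) (φ : Fin d → ℝ) (s : 𝒮) :
    0 ≤ feasDist 𝒳 g xhat φ s :=
  Metric.hausdorffDist_nonneg

lemma feasible_anti {Φ : Set (Fin d → ℝ)}
    (hg : ∀ x ∈ 𝒳, ∀ s, IsLatticeHomOn Φ (fun φ => g x φ s)) {φ φ' : Fin d → ℝ}
    (hφ : φ ∈ Φ) (hφ' : φ' ∈ Φ) (hle : φ ≤ φ') (s : 𝒮) :
    feasible 𝒳 g φ' s ⊆ feasible 𝒳 g φ s := by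
  rintro x ⟨hx, hgx⟩
  refine ⟨hx, le_trans ?_ hgx⟩
  have h := (hg x hx s φ hφ φ' hφ').1
  rw [inf_eq_left.2 hle] at h
  exact inf_eq_left.1 h.symm

end Loss

/-! ### Countable cofinal families -/

section Cofinal

lemma exists_seq_cofinal_of_bddAbove {A : Set ℝ} (hne : A.Nonempty) (hb : BddAbove A) :
    ∃ u : ℕ → ℝ, (∀ m, u m ∈ A) ∧ ∀ a ∈ A, ∃ m, a ≤ u m := by
  by_cases hmem : sSup A ∈ A
  · exact ⟨fun _ => sSup A, fun _ => hmem, fun a ha => ⟨0, le_csSup hb ha⟩⟩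
  · obtain ⟨u, -, hu, hum⟩ := exists_seq_tendsto_sSup hne hb
    refine ⟨u, hum, fun a ha => ?_⟩
    have hlt : a < sSup A := lt_of_le_of_ne (le_csSup hb ha) fun h => hmem (h ▸ ha)
    obtain ⟨m, hm⟩ := (hu.eventually (lt_mem_nhds hlt)).exists
    exact ⟨m, hm.le⟩

/-- A bounded sup-closed set of vectors has a countable cofinal subset. -/
lemma exists_countable_cofinal {d : ℕ} {T : Set (Fin d → ℝ)} (hne : T.Nonempty)
    (hb : BddAbove T) (hsup : SupClosed T) :
    ∃ ψ : (Fin d → ℕ) → Fin d → ℝ, (∀ e, ψ e ∈ T) ∧ ∀ φ ∈ T, ∃ e, φ ≤ ψ e := by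
  obtain ⟨φ₀, hφ₀⟩ := hne
  have hcoord : ∀ j : Fin d, ∃ w : ℕ → Fin d → ℝ, (∀ m, w m ∈ T) ∧
      ∀ φ ∈ T, ∃ m, φ j ≤ w m j := by
    intro j
    obtain ⟨B, hB⟩ := hb
    obtain ⟨u, hu, hcof⟩ := exists_seq_cofinal_of_bddAbove (A := (fun φ => φ j) '' T)
      ⟨_, φ₀, hφ₀, rfl⟩ ⟨B j, by rintro _ ⟨φ, hφ, rfl⟩; exact hB hφ j⟩
    choose w hw hwu using hu
    refine ⟨w, hw, fun φ hφ => ?_⟩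
    obtain ⟨m, hm⟩ := hcof _ ⟨φ, hφ, rfl⟩
    exact ⟨m, hm.trans (hwu m).symm.le⟩
  choose w hw hcof using hcoord
  -- A member of the family is the join of one sequence entry per coordinate; the extra entry `φ₀`
  -- keeps the join nonempty when `d = 0`.
  let v : (Fin d → ℕ) → Option (Fin d) → Fin d → ℝ := fun e o => o.elim φ₀ fun j => w j (e j)
  refine ⟨fun e => Finset.univ.sup' Finset.univ_nonempty (v e), fun e => ?_, fun φ hφ => ?_⟩
  · refine hsup.finsetSup'_mem Finset.univ_nonempty fun o _ => ?_
    cases o with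
    | none => exact hφ₀
    | some j => exact hw j _
  · choose e he using fun j => hcof j φ hφ
    refine ⟨e, fun j => (he j).trans ?_⟩
    exact Finset.le_sup' (v e) (Finset.mem_univ (some j)) j

end Cofinal

lemma eq_of_mem_stdSimplex_one {θ θ' : Fin 1 → ℝ} (hθ : θ ∈ stdSimplex ℝ (Fin 1))
    (hθ' : θ' ∈ stdSimplex ℝ (Fin 1)) : θ = θ' := by
  funext i
  have h1 := hθ.2
  have h2 := hθ'.2
  simp only [Fin.sum_univ_one] at h1 h2
  rw [Subsingleton.elim i 0, h1, h2]

lemma one_le_of_mem_stdSimplex {D : ℕ} {θ : Fin D → ℝ} (hθ : θ ∈ stdSimplex ℝ (Fin D)) :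
    1 ≤ D := by
  rcases Nat.eq_zero_or_pos D with rfl | h
  · simpa using hθ.2
  · exact h

/-! ### Failure probability of learning -/

section Learning

variable {𝒮 : Type*} [MeasurableSpace 𝒮] (P : Measure 𝒮) [IsProbabilityMeasure P]
  {k D d J N : ℕ} {𝒳 : Set (EuclideanSpace ℝ (Fin k))} {Φ : Set (Fin d → ℝ)}
  {f : EuclideanSpace ℝ (Fin k) → 𝒮 → EuclideanSpace ℝ (Fin D)}
  {g : EuclideanSpace ℝ (Fin k) → (Fin d → ℝ) → 𝒮 → (Fin J → ℝ)}
  {Lf : ℝ} {xhat : 𝒮 → EuclideanSpace ℝ (Fin k)} {θtrue : Fin D → ℝ} {φtrue : Fin d → ℝ}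

/-- The sign of `Lf` is not assumed. A negative constant forces one-point feasible sets, so the
product of `Lf` with the norm is never negative. -/
lemma psi2Norm_feasDist_eq_zero_of_neg (hLf : Lf < 0)
    (hf : ∀ s, ∀ x ∈ 𝒳, ∀ x' ∈ 𝒳, ‖f x s - f x' s‖ ≤ Lf * ‖x - x'‖)
    (hmem : ∀ s, xhat s ∈ feasible 𝒳 g φtrue s) :
    psi2Norm P (feasDist 𝒳 g xhat φtrue) = 0 := by
  have hz : feasDist 𝒳 g xhat φtrue = fun _ => 0 := by
    funext s
    have : feasible 𝒳 g φtrue s = {xhat s} := by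
      refine Set.eq_singleton_iff_unique_mem.2 ⟨hmem s, fun y hy => ?_⟩
      have h1 := (norm_nonneg _).trans (hf s y hy.1 (xhat s) (hmem s).1)
      have h2 : ‖y - xhat s‖ = 0 := by nlinarith [norm_nonneg (y - xhat s)]
      exact sub_eq_zero.1 (norm_eq_zero.1 h2)
    rw [feasDist, this, Metric.hausdorffDist_self_zero]
  rw [hz, psi2Norm_zero]

lemma measure_pi_exists_loss_gap_le (hN : 0 < N)
    (hf : ∀ s, ∀ x ∈ 𝒳, ∀ x' ∈ 𝒳, ‖f x s - f x' s‖ ≤ Lf * ‖x - x'‖)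
    (hcomp : ∀ s, IsCompact (feasible 𝒳 g φtrue s)) (hθtrue : θtrue ∈ stdSimplex ℝ (Fin D))
    (hopt : ∀ s, xhat s ∈ FOP 𝒳 f g θtrue φtrue s)
    (hloss : ∀ θ ∈ stdSimplex ℝ (Fin D),
      AEMeasurable (fun s => suboptLoss 𝒳 f g 0 (xhat s) θ φtrue s) P)
    (hdist : AEMeasurable (feasDist 𝒳 g xhat φtrue) P)
    (hsub : IsSubGaussian P (feasDist 𝒳 g xhat φtrue)) {b : ℝ} (hb : 0 ≤ b) :
    (Measure.pi fun _ : Fin N => P)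
        {s | ∃ θ ∈ stdSimplex ℝ (Fin D),
          ∑ n, suboptLoss 𝒳 f g 0 (xhat (s n)) θ φtrue (s n) = 0 ∧
          Lf * psi2Norm P (feasDist 𝒳 g xhat φtrue) * b / √N
            < ∫ x, suboptLoss 𝒳 f g 0 (xhat x) θ φtrue x ∂P}
      ≤ ENNReal.ofReal (((D : ℝ) - 1) * Real.exp (-b ^ 2 / 24 + 4 * ((D : ℝ) - 1))) := by
  set K₀ := psi2Norm P (feasDist 𝒳 g xhat φtrue) with hK₀
  have hK₀nonneg : 0 ≤ K₀ := psi2Norm_nonneg P _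
  have hLK : 0 ≤ Lf * K₀ := by
    rcases le_or_gt 0 Lf with h | h
    · positivity
    · rw [hK₀, psi2Norm_feasDist_eq_zero_of_neg P h hf fun s => (hopt s).1, mul_zero]
  -- Covers the degenerate cases of zero norm, `Lf = 0` and `D = 1`: the excess loss is zero and
  -- cannot exceed a nonnegative threshold.
  have hdeg : (∀ θ ∈ stdSimplex ℝ (Fin D),
      ∀ᵐ s ∂P, suboptLoss 𝒳 f g 0 (xhat s) θ φtrue s = 0) →
      (Measure.pi fun _ : Fin N => P)
        {s | ∃ θ ∈ stdSimplex ℝ (Fin D),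
          ∑ n, suboptLoss 𝒳 f g 0 (xhat (s n)) θ φtrue (s n) = 0 ∧
          Lf * K₀ * b / √N < ∫ x, suboptLoss 𝒳 f g 0 (xhat x) θ φtrue x ∂P}
      ≤ ENNReal.ofReal (((D : ℝ) - 1) * Real.exp (-b ^ 2 / 24 + 4 * ((D : ℝ) - 1))) := by
    intro hz
    refine le_of_eq_of_le (measure_mono_null ?_ measure_empty) zero_le
    rintro s ⟨θ, hθ, -, hlt⟩
    rw [integral_congr_ae (hz θ hθ), integral_zero] at hlt
    exact absurd hlt (not_lt.2 (by positivity))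
  have hRle : ∀ s, ∀ y ∈ feasible 𝒳 g φtrue s,
      ‖f y s - f (xhat s) s‖ ≤ |Lf| * feasDist 𝒳 g xhat φtrue s := fun s y hy =>
    (hf s y hy.1 _ (hopt s).1.1).trans (mul_le_mul (le_abs_self _)
      (norm_sub_le_feasDist (hcomp s) hy) (norm_nonneg _) (abs_nonneg _))
  have hL : ∀ s, ∀ θ θ' : Fin D → ℝ, suboptLoss 𝒳 f g 0 (xhat s) θ φtrue s
      - suboptLoss 𝒳 f g 0 (xhat s) θ' φtrue s
      ≤ |Lf| * feasDist 𝒳 g xhat φtrue s * √(sqLen (θ - θ')) := fun s θ θ' =>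
    suboptLoss_sub_le (hopt s).1 (hRle s) θ θ'
  have h2 : ∀ θ ∈ stdSimplex ℝ (Fin D), ∀ s, suboptLoss 𝒳 f g 0 (xhat s) θ φtrue s
      ≤ 2 * (|Lf| * feasDist 𝒳 g xhat φtrue s) := by
    intro θ hθ s
    have h1 := hL s θ θtrue
    rw [suboptLoss_eq_zero (hopt s), sub_zero] at h1
    have h3 := mul_le_mul_of_nonneg_left (sqrt_sqLen_sub_le_two hθ hθtrue)
      (mul_nonneg (abs_nonneg Lf) (feasDist_nonneg (𝒳 := 𝒳) (g := g) xhat φtrue s))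
    linarith
  rcases hK₀nonneg.eq_or_lt with hzero | hpos
  · refine hdeg fun θ hθ => ?_
    filter_upwards [ae_eq_zero_of_psi2Norm_eq_zero P hdist (fun s => feasDist_nonneg _ _ _) hsub
      hzero.symm] with s hs
    have := h2 θ hθ s
    rw [hs] at this
    exact le_antisymm (by simpa using this) (suboptLoss_nonneg _ _ _ _)
  rcases lt_trichotomy Lf 0 with hneg | hLf0 | hLfpos
  · exact absurd (psi2Norm_feasDist_eq_zero_of_neg P hneg hf fun s => (hopt s).1) hpos.ne'
  · refine hdeg fun θ hθ => Filter.Eventually.of_forall fun s => ?_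
    have := h2 θ hθ s
    rw [hLf0] at this
    exact le_antisymm (by simpa using this) (suboptLoss_nonneg _ _ _ _)
  rcases (one_le_of_mem_stdSimplex hθtrue).eq_or_lt with hD1 | hD2
  · subst hD1
    refine hdeg fun θ hθ => Filter.Eventually.of_forall fun s => ?_
    rw [eq_of_mem_stdSimplex_one hθ hθtrue]
    exact suboptLoss_eq_zero (hopt s)
  rw [abs_of_pos hLfpos] at *
  refine (measure_pi_exists_simplex_gap_le P hN ⟨_, hθtrue⟩
    (fun θ s => suboptLoss 𝒳 f g 0 (xhat s) θ φtrue s) hloss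
    (fun s => Lf * feasDist 𝒳 g xhat φtrue s) (hdist.const_mul _)
    (fun s θ _ θ' _ => hL s θ θ') (fun θ _ s => suboptLoss_nonneg _ _ _ _) h2
    (mul_pos hLfpos hpos) ?_ hb).trans (ENNReal.ofReal_le_ofReal ?_)
  · have := lintegral_exp_psi2Norm_le P hdist hsub hpos
    rw [← hK₀] at this
    convert this using 5 with s
    rw [mul_pow, mul_pow, mul_div_mul_left _ _ (by positivity)]
  · have hD : (2 : ℝ) ≤ D := by exact_mod_cast hD2
    -- For `D ≥ 2` one has `2 * D ≤ 4 * (D - 1)`, and the prefactor `D - 1 ≥ 1` is free; it makes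
    -- the bound vanish for `D = 1`.
    have h1 : -b ^ 2 / 24 + 2 * (D : ℝ) ≤ -b ^ 2 / 24 + 4 * ((D : ℝ) - 1) := by linarith
    exact (Real.exp_le_exp.2 h1).trans (le_mul_of_one_le_left (Real.exp_pos _).le (by linarith))

lemma measure_pi_forall_mem_le (A : Set 𝒮) :
    (Measure.pi fun _ : Fin N => P) {s | ∀ n, s n ∈ A} ≤ P A ^ N := by
  have : {s : Fin N → 𝒮 | ∀ n, s n ∈ A} = Set.univ.pi fun _ => A := by
    ext s; simp
  rw [this, Measure.pi_pi]
  simp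

/-- The failure probability of exact constraint learning together with the excess loss bound. -/
lemma measure_pi_learning_failure_le (hN : 0 < N) (hΦ : IsSublattice Φ)
    (hg : ∀ x ∈ 𝒳, ∀ s, IsLatticeHomOn Φ (fun φ => g x φ s))
    (hf : ∀ s, ∀ x ∈ 𝒳, ∀ x' ∈ 𝒳, ‖f x s - f x' s‖ ≤ Lf * ‖x - x'‖)
    (hcomp : ∀ φ ∈ Φ, ∀ s, IsCompact (feasible 𝒳 g φ s))
    (hθtrue : θtrue ∈ stdSimplex ℝ (Fin D)) (hφtrue : φtrue ∈ Φ)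
    (hopt : ∀ s, xhat s ∈ FOP 𝒳 f g θtrue φtrue s) (lam : ℝ)
    (hloss : ∀ θ ∈ stdSimplex ℝ (Fin D), ∀ φ ∈ Φ,
      AEMeasurable (fun s => suboptLoss 𝒳 f g lam (xhat s) θ φ s) P)
    (hdist : AEMeasurable (feasDist 𝒳 g xhat φtrue) P)
    (hsub : IsSubGaussian P (feasDist 𝒳 g xhat φtrue))
    {δ : Fin d → ℝ} (hδ : 0 ≤ δ)
    (hclass : ∀ φ ∈ Φ ∩ Set.Icc φtrue (φtrue + δ), ParamEquiv P 𝒳 g φ φtrue)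
    {φsup : 𝒮 → Fin d → ℝ} (hφsup : ∀ s, IsPhiSup Φ g xhat {s} (φsup s))
    {θN : (Fin N → 𝒮) → Fin D → ℝ} {φN : (Fin N → 𝒮) → Fin d → ℝ}
    (hlearn : ∀ smp : Fin N → 𝒮, IsLearned 𝒳 Φ f g xhat smp (θN smp) (φN smp))
    {b : ℝ} (hb : 0 ≤ b) :
    (Measure.pi fun _ : Fin N => P)
        {s | ¬ (ParamEquiv P 𝒳 g (φN s) φtrue ∧
          expLoss P 𝒳 f g xhat lam (θN s) (φN s) - expLoss P 𝒳 f g xhat lam θtrue φtrue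
            ≤ Lf * psi2Norm P (feasDist 𝒳 g xhat φtrue) * b / √N)}
      ≤ ∑ j, P {s | φtrue j + δ j ≤ φsup s j} ^ N
        + ENNReal.ofReal (((D : ℝ) - 1) * Real.exp (-b ^ 2 / 24 + 4 * ((D : ℝ) - 1))) := by
  have hmem : ∀ s, xhat s ∈ feasible 𝒳 g φtrue s := fun s => (hopt s).1
  have hloss' : ∀ θ ∈ stdSimplex ℝ (Fin D),
      AEMeasurable (fun s => suboptLoss 𝒳 f g 0 (xhat s) θ φtrue s) P := by
    intro θ hθ
    have := hloss θ hθ φtrue hφtrue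
    simpa only [fun s => suboptLoss_eq_of_mem_feasible (f := f) (hmem s) lam θ] using this
  have hgap := measure_pi_exists_loss_gap_le P hN hf (hcomp φtrue hφtrue) hθtrue hopt hloss' hdist
    hsub hb
  have hTne : (Φ ∩ Set.Icc φtrue (φtrue + δ)).Nonempty :=
    ⟨φtrue, hφtrue, le_rfl, le_add_of_nonneg_right hδ⟩
  obtain ⟨ψ, hψ, hcof⟩ := exists_countable_cofinal hTne ⟨φtrue + δ, fun φ hφ => hφ.2.2⟩
    (fun a ha c hc => ⟨hΦ.supClosed ha.1 hc.1, ha.2.1.trans le_sup_left, sup_le ha.2.2 hc.2.2⟩)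
  have hψae : ∀ᵐ s ∂P, ∀ e, feasible 𝒳 g (ψ e) s = feasible 𝒳 g φtrue s :=
    ae_all_iff.2 fun e => hclass _ (hψ e)
  have hall : ∀ᵐ s ∂(Measure.pi fun _ : Fin N => P),
      ∀ n e, feasible 𝒳 g (ψ e) (s n) = feasible 𝒳 g φtrue (s n) :=
    ae_all_iff.2 fun n =>
      (measurePreserving_eval (fun _ : Fin N => P) n).quasiMeasurePreserving.ae hψae
  set A₁ : Fin d → Set (Fin N → 𝒮) := fun j => {s | ∀ n, s n ∈ {s | φtrue j + δ j ≤ φsup s j}}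
    with hA₁
  set A₂ : Set (Fin N → 𝒮) := {s | ∃ θ ∈ stdSimplex ℝ (Fin D),
    ∑ n, suboptLoss 𝒳 f g 0 (xhat (s n)) θ φtrue (s n) = 0 ∧
    Lf * psi2Norm P (feasDist 𝒳 g xhat φtrue) * b / √N
      < ∫ x, suboptLoss 𝒳 f g 0 (xhat x) θ φtrue x ∂P} with hA₂
  refine le_trans (measure_mono_ae (t := (⋃ j, A₁ j) ∪ A₂) ?_) ((measure_union_le _ _).trans
    (add_le_add ((measure_iUnion_fintype_le _ _).trans
      (Finset.sum_le_sum fun j _ => measure_pi_forall_mem_le P _)) hgap))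
  filter_upwards [hall] with s hs hbad
  by_contra hnot
  obtain ⟨hn₁, hn₂⟩ := not_or.1 (mt (Set.mem_union s _ _).2 hnot)
  refine hbad ?_
  obtain ⟨hphi, hθN, hmin⟩ := hlearn s
  have hφNΦ : φN s ∈ Φ := hphi.1.1
  have hge : φtrue ≤ φN s := hphi.2 ⟨hφtrue, fun t _ => (hmem t).2⟩
  have hle : φN s ≤ φtrue + δ := by
    intro j
    have hj : s ∉ A₁ j := fun h => hn₁ (Set.mem_iUnion.2 ⟨j, h⟩)
    simp only [hA₁, Set.mem_ofPred_eq, not_forall, not_le] at hj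
    obtain ⟨n, hn⟩ := hj
    have hsupn : φN s ≤ φsup (s n) := (hφsup (s n)).2 ⟨hφNΦ, fun t ht => by
      rw [Set.mem_singleton_iff.1 ht]
      exact hphi.1.2 _ ⟨n, rfl⟩⟩
    exact (hsupn j).trans hn.le
  have hT : φN s ∈ Φ ∩ Set.Icc φtrue (φtrue + δ) := ⟨hφNΦ, hge, hle⟩
  have hequiv := hclass _ hT
  have hfeas : ∀ n, feasible 𝒳 g (φN s) (s n) = feasible 𝒳 g φtrue (s n) := by
    intro n
    obtain ⟨e, he⟩ := hcof _ hT
    -- Squeeze: for a cofinal `ψ e` above `φN s`, the feasible set of `φN s` lies between those of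
    -- `ψ e` and `φtrue`, which agree at the sample points.
    refine Set.Subset.antisymm (feasible_anti hg hφtrue hφNΦ hge _) ?_
    rw [← hs n e]
    exact feasible_anti hg hφNΦ (hψ e).1 he _
  have hemp : ∀ θ, ∑ n, suboptLoss 𝒳 f g 0 (xhat (s n)) θ (φN s) (s n)
      = ∑ n, suboptLoss 𝒳 f g 0 (xhat (s n)) θ φtrue (s n) := fun θ =>
    Finset.sum_congr rfl fun n _ => suboptLoss_congr_feasible (hfeas n) _ _
  have hzero : ∑ n, suboptLoss 𝒳 f g 0 (xhat (s n)) (θN s) φtrue (s n) = 0 := by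
    refine le_antisymm ?_ (Finset.sum_nonneg fun n _ => suboptLoss_nonneg _ _ _ _)
    have h := hmin hθtrue
    simp only [Set.mem_ofPred_eq, hemp] at h
    have htrue : ∑ n, suboptLoss 𝒳 f g 0 (xhat (s n)) θtrue φtrue (s n) = 0 :=
      Finset.sum_eq_zero fun n _ => suboptLoss_eq_zero (hopt _)
    rw [htrue] at h
    have hNR : (0 : ℝ) < N := Nat.cast_pos.2 hN
    exact le_of_mul_le_mul_left h (by positivity)
  refine ⟨hequiv, ?_⟩
  have e1 : expLoss P 𝒳 f g xhat lam (θN s) (φN s)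
      = ∫ x, suboptLoss 𝒳 f g 0 (xhat x) (θN s) φtrue x ∂P := by
    refine integral_congr_ae ?_
    filter_upwards [hequiv] with t ht
    rw [suboptLoss_eq_of_mem_feasible (by rw [ht]; exact hmem t) lam,
      suboptLoss_congr_feasible ht]
  have e2 : expLoss P 𝒳 f g xhat lam θtrue φtrue = 0 := by
    rw [expLoss]
    simp only [fun s => suboptLoss_eq_of_mem_feasible (f := f) (hmem s) lam θtrue,
      fun s => suboptLoss_eq_zero (hopt s), integral_zero]
  rw [e1, e2, sub_zero]
  by_contra hlt
  exact hn₂ ⟨θN s, hθN, hzero, not_le.1 hlt⟩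

end Learning

/-! ### Comparison of the tail with the stated constants -/

section Numerics

lemma two_rpow_neg_le_riemannZeta_sub_one {z : ℝ} (hz : 1 < z) :
    (2 : ℝ) ^ (-z) ≤ (riemannZeta (z : ℂ)).re - 1 := by
  have hre : ∀ n : ℕ, (1 / (n : ℂ) ^ (z : ℂ)) = ((1 / (n : ℝ) ^ z : ℝ) : ℂ) := by
    intro n
    rw [Complex.ofReal_div, Complex.ofReal_one, Complex.ofReal_cpow (Nat.cast_nonneg n),
      Complex.ofReal_natCast]
  have hsum : Summable fun n : ℕ => 1 / (n : ℝ) ^ z := Real.summable_one_div_nat_rpow.2 hz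
  rw [zeta_eq_tsum_one_div_nat_cpow (by simpa using hz), tsum_congr hre, ← Complex.ofReal_tsum,
    Complex.ofReal_re]
  have h := hsum.sum_le_tsum {1, 2} fun n _ => by positivity
  rw [Finset.sum_pair (by norm_num)] at h
  simp only [Nat.cast_one, Real.one_rpow, Nat.cast_ofNat] at h
  rw [Real.rpow_neg (by norm_num), ← one_div]
  linarith

lemma seven_le_chaining_const : 7 ≤ (1 + √Real.pi / √(Real.log 2)) * √6 := by
  have hlog : 0 < √(Real.log 2) := Real.sqrt_pos.2 (Real.log_pos (by norm_num))
  have h1 : 2 ≤ √Real.pi / √(Real.log 2) := by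
    rw [le_div_iff₀ hlog]
    refine Real.le_sqrt_of_sq_le ?_
    rw [mul_pow, Real.sq_sqrt (Real.log_nonneg (by norm_num))]
    linarith [Real.pi_gt_three, Real.log_two_lt_d9]
  have h2 : (7 / 3 : ℝ) ≤ √6 := Real.le_sqrt_of_sq_le (by norm_num)
  nlinarith

/-- The prefactor is absorbed by `x ≤ exp x`, and the cross term of the square is dropped. -/
lemma mul_exp_tail_le {c u x b : ℝ} (hc : 0 ≤ c) (hu : 0 ≤ u) (hx : 0 ≤ x)
    (hb : c * (3 * √x + u) ≤ b) :
    x * Real.exp (-b ^ 2 / 24 + 4 * x)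
      ≤ Real.exp (-(c ^ 2 * (9 * x + u ^ 2)) / 24 + 5 * x) := by
  have hsx := Real.sq_sqrt hx
  have hsx0 := Real.sqrt_nonneg x
  have hb2 : c ^ 2 * (9 * x + u ^ 2) ≤ b ^ 2 := by
    calc c ^ 2 * (9 * x + u ^ 2) ≤ c ^ 2 * (3 * √x + u) ^ 2 := by
          gcongr
          nlinarith [mul_nonneg hsx0 hu]
      _ = (c * (3 * √x + u)) ^ 2 := by ring
      _ ≤ b ^ 2 := by gcongr
  calc x * Real.exp (-b ^ 2 / 24 + 4 * x)
      ≤ Real.exp x * Real.exp (-b ^ 2 / 24 + 4 * x) := by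
        gcongr
        linarith [Real.add_one_le_exp x]
    _ = Real.exp (-b ^ 2 / 24 + 5 * x) := by rw [← Real.exp_add]; ring_nf
    _ ≤ _ := by gcongr

lemma exp_tail_le_zeta {C u x b : ℝ} (hC : 3 * √3 < C) (hu : 0 ≤ u) (hx : x = 0 ∨ 1 ≤ x)
    (hb : 7 * C * (3 * √x + u) ≤ b) :
    x * Real.exp (-b ^ 2 / 24 + 4 * x)
      ≤ 2 * ((riemannZeta ((C ^ 2 / 9 - 2 : ℝ) : ℂ)).re - 1) * Real.exp (-(C ^ 2 / 9) * u ^ 2) := by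
  have h3 : √(3 : ℝ) ^ 2 = 3 := Real.sq_sqrt (by norm_num)
  have hs3 : 0 < √(3 : ℝ) := Real.sqrt_pos.2 (by norm_num)
  have hC0 : 0 < C := lt_trans (by positivity) hC
  -- This makes the zeta argument exceed `27 / 9 - 2 = 1`, so its series converges and its second
  -- term `2 ^ (-z)` bounds `ζ(z) - 1` from below.
  have hC2 : 27 < C ^ 2 := by nlinarith
  have hz := two_rpow_neg_le_riemannZeta_sub_one (z := C ^ 2 / 9 - 2) (by linarith)
  have hz0 : 0 < (2 : ℝ) ^ (-(C ^ 2 / 9 - 2)) := by positivity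
  rcases hx with rfl | hx
  · rw [zero_mul]
    exact mul_nonneg (by linarith) (Real.exp_pos _).le
  refine (mul_exp_tail_le (by positivity) hu (by linarith) hb).trans ?_
  calc _ ≤ Real.exp (-(C ^ 2 / 9 - 2) * Real.log 2 + -(C ^ 2 / 9) * u ^ 2) := by
        refine Real.exp_le_exp.2 ?_
        have hl := Real.log_two_lt_d9
        have hl0 : 0 < Real.log 2 := Real.log_pos (by norm_num)
        have h5 : (C ^ 2 / 9 - 2) * Real.log 2 ≤ C ^ 2 / 9 := by nlinarith
        have h6 : 0 ≤ C ^ 2 * u ^ 2 := by positivity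
        have h7 : C ^ 2 ≤ C ^ 2 * x := le_mul_of_one_le_right (by positivity) hx
        have h8 : 27 * x ≤ C ^ 2 * x := by gcongr
        linarith
    _ = (2 : ℝ) ^ (-(C ^ 2 / 9 - 2)) * Real.exp (-(C ^ 2 / 9) * u ^ 2) := by
        rw [Real.exp_add, Real.rpow_def_of_pos (by norm_num), mul_comm (Real.log 2)]
    _ ≤ _ := by
        gcongr
        linarith

lemma exp_tail_le_three_mul {u x b : ℝ} (hu : 0 ≤ u) (hx : 0 ≤ x)
    (hb : 44 * (3 * √x + u) ≤ b) :
    x * Real.exp (-b ^ 2 / 24 + 4 * x) ≤ 3 * Real.exp (-3 * u ^ 2) := by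
  refine (mul_exp_tail_le (by norm_num) hu hx hb).trans ?_
  refine le_trans (Real.exp_le_exp.2 ?_) (le_mul_of_one_le_left (Real.exp_pos _).le (by norm_num))
  nlinarith [sq_nonneg u]

end Numerics

end InvOpt

theorem mainTheorem6
    {𝒮 Ω : Type*} [MeasurableSpace 𝒮] [MeasurableSpace Ω]
    (P : Measure 𝒮) [IsProbabilityMeasure P]
    (μ : Measure Ω) [IsProbabilityMeasure μ]
    {k D d J N : ℕ} (hN : 0 < N)
    (𝒳 : Set (EuclideanSpace ℝ (Fin k))) (Φ : Set (Fin d → ℝ))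
    (f : EuclideanSpace ℝ (Fin k) → 𝒮 → EuclideanSpace ℝ (Fin D))
    (g : EuclideanSpace ℝ (Fin k) → (Fin d → ℝ) → 𝒮 → (Fin J → ℝ))
    -- `Φ` is a lattice and the constraints are lattice homomorphisms in the parameter
    (hΦ : IsSublattice Φ)
    (hg : ∀ x ∈ 𝒳, ∀ s, InvOpt.IsLatticeHomOn Φ (fun φ => g x φ s))
    -- the features are Lipschitz and the feasible sets are compact
    (Lf : ℝ)
    (hf : ∀ s, ∀ x ∈ 𝒳, ∀ x' ∈ 𝒳, ‖f x s - f x' s‖ ≤ Lf * ‖x - x'‖)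
    (hcomp : ∀ φ ∈ Φ, ∀ s, IsCompact (InvOpt.feasible 𝒳 g φ s))
    -- `xhat` is an optimal solution map with true parameters `θtrue`, `φtrue`
    (xhat : 𝒮 → EuclideanSpace ℝ (Fin k))
    (θtrue : Fin D → ℝ) (hθtrue : θtrue ∈ stdSimplex ℝ (Fin D))
    (φtrue : Fin d → ℝ) (hφtrue : φtrue ∈ Φ)
    (hopt : ∀ s, xhat s ∈ InvOpt.FOP 𝒳 f g θtrue φtrue s)
    (lam : ℝ) (hlam : 0 ≤ lam)
    -- measurability, and sub-Gaussianity of the distance whose norm enters the bound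
    (hloss : ∀ θ ∈ stdSimplex ℝ (Fin D), ∀ φ ∈ Φ,
      AEMeasurable (fun s => InvOpt.suboptLoss 𝒳 f g lam (xhat s) θ φ s) P)
    (hdist : AEMeasurable (InvOpt.feasDist 𝒳 g xhat φtrue) P)
    (hsub : InvOpt.IsSubGaussian P (InvOpt.feasDist 𝒳 g xhat φtrue))
    -- `Φ(δ)` consists of a single equivalence class
    (δ : Fin d → ℝ) (hδ : 0 ≤ δ)
    (hclass : ∀ φ ∈ Φ ∩ Set.Icc φtrue (φtrue + δ), InvOpt.ParamEquiv P 𝒳 g φ φtrue)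
    -- the one-state constraint parameters `φ^sup({s})`
    (φsup : 𝒮 → Fin d → ℝ)
    (hφsup : ∀ s, InvOpt.IsPhiSup Φ g xhat {s} (φsup s))
    -- the i.i.d. sample, and the parameters learned from it
    (S : Fin N → Ω → 𝒮) (hS : ∀ n, Measurable (S n))
    (hindep : iIndepFun S μ) (hlaw : ∀ n, μ.map (S n) = P)
    (θN : (Fin N → 𝒮) → Fin D → ℝ) (φN : (Fin N → 𝒮) → Fin d → ℝ)
    (hlearn : ∀ smp : Fin N → 𝒮, InvOpt.IsLearned 𝒳 Φ f g xhat smp (θN smp) (φN smp)) :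
    (∀ C : ℝ, 3 * √3 < C → ∀ u : ℝ, 0 ≤ u →
      μ.real {ω | ¬ (InvOpt.ParamEquiv P 𝒳 g (φN (fun n => S n ω)) φtrue ∧
          InvOpt.expLoss P 𝒳 f g xhat lam (θN (fun n => S n ω)) (φN (fun n => S n ω))
            - InvOpt.expLoss P 𝒳 f g xhat lam θtrue φtrue
          ≤ (1 + √Real.pi / √(Real.log 2)) * (√6 * Lf * C / √N)
            * (3.01 * InvOpt.psi2Norm P (InvOpt.feasDist 𝒳 g xhat φtrue) * √((D : ℝ) - 1)
              + u * InvOpt.psi2Norm P (InvOpt.feasDist 𝒳 g xhat φtrue)))}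
        ≤ ∑ j, P.real {s | φtrue j + δ j ≤ φsup s j} ^ N
          + 2 * ((riemannZeta ((C ^ 2 / 9 - 2 : ℝ) : ℂ)).re - 1) * Real.exp (-(C ^ 2 / 9) * u ^ 2))
    ∧
    (∀ u : ℝ, 0 ≤ u →
      μ.real {ω | ¬ (InvOpt.ParamEquiv P 𝒳 g (φN (fun n => S n ω)) φtrue ∧
          InvOpt.expLoss P 𝒳 f g xhat lam (θN (fun n => S n ω)) (φN (fun n => S n ω))
            - InvOpt.expLoss P 𝒳 f g xhat lam θtrue φtrue
          ≤ 44 * Lf * InvOpt.psi2Norm P (InvOpt.feasDist 𝒳 g xhat φtrue) / √N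
            * (3.01 * √((D : ℝ) - 1) + u))}
        ≤ ∑ j, P.real {s | φtrue j + δ j ≤ φsup s j} ^ N + 3 * Real.exp (-3 * u ^ 2)) := by
  have key : ∀ b : ℝ, 0 ≤ b →
      μ.real {ω | ¬ (InvOpt.ParamEquiv P 𝒳 g (φN (fun n => S n ω)) φtrue ∧
          InvOpt.expLoss P 𝒳 f g xhat lam (θN (fun n => S n ω)) (φN (fun n => S n ω))
            - InvOpt.expLoss P 𝒳 f g xhat lam θtrue φtrue
          ≤ Lf * InvOpt.psi2Norm P (InvOpt.feasDist 𝒳 g xhat φtrue) * b / √N)}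
        ≤ ∑ j, P.real {s | φtrue j + δ j ≤ φsup s j} ^ N
          + ((D : ℝ) - 1) * Real.exp (-b ^ 2 / 24 + 4 * ((D : ℝ) - 1)) := by
    intro b hb
    have hpi : μ.map (fun ω n => S n ω) = Measure.pi fun _ : Fin N => P := by
      rw [(iIndepFun_iff_map_fun_eq_pi_map fun n => (hS n).aemeasurable).1 hindep]
      simp only [hlaw]
    have hfail := InvOpt.measure_pi_learning_failure_le P hN hΦ hg hf hcomp hθtrue hφtrue hopt lam
      hloss hdist hsub hδ hclass hφsup hlearn hb
    rw [← hpi] at hfail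
    -- The failure event need not be measurable; this inequality still holds for outer measures.
    have hle := (Measure.le_map_apply (measurable_pi_lambda _ hS).aemeasurable _).trans hfail
    have hD : (0 : ℝ) ≤ (D : ℝ) - 1 := by
      have : (1 : ℝ) ≤ D := by exact_mod_cast InvOpt.one_le_of_mem_stdSimplex hθtrue
      linarith
    have hsum : ∑ j, P {s | φtrue j + δ j ≤ φsup s j} ^ N ≠ ⊤ :=
      ENNReal.sum_ne_top.2 fun j _ => ENNReal.pow_ne_top (measure_ne_top _ _)
    have := ENNReal.toReal_mono (ENNReal.add_ne_top.2 ⟨hsum, ENNReal.ofReal_ne_top⟩) hle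
    rw [ENNReal.toReal_add hsum ENNReal.ofReal_ne_top, ENNReal.toReal_ofReal (by positivity),
      ENNReal.toReal_sum fun j _ => ENNReal.pow_ne_top (measure_ne_top _ _)] at this
    simp only [ENNReal.toReal_pow] at this
    exact this
  have hD1 := InvOpt.one_le_of_mem_stdSimplex hθtrue
  have hD : (D : ℝ) - 1 = 0 ∨ 1 ≤ (D : ℝ) - 1 := by
    rcases hD1.eq_or_lt with h | h
    · left; rw [← h]; simp
    · right
      have : (2 : ℝ) ≤ D := by exact_mod_cast h
      linarith
  have hD0 : 0 ≤ (D : ℝ) - 1 := by rcases hD with h | h <;> linarith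
  have hsD := Real.sqrt_nonneg ((D : ℝ) - 1)
  refine ⟨fun C hC u hu => ?_, fun u hu => ?_⟩
  · have hC0 : 0 < C := lt_trans (by positivity) hC
    have hb : 7 * C * (3 * √((D : ℝ) - 1) + u)
        ≤ (1 + √Real.pi / √(Real.log 2)) * √6 * C * (3.01 * √((D : ℝ) - 1) + u) := by
      have := InvOpt.seven_le_chaining_const
      gcongr
      norm_num
    refine le_trans (le_of_eq ?_) ((key _ (le_trans (by positivity) hb)).trans
      (add_le_add le_rfl (InvOpt.exp_tail_le_zeta hC hu hD hb)))
    rw [show (1 + √Real.pi / √(Real.log 2)) * (√6 * Lf * C / √N)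
        * (3.01 * InvOpt.psi2Norm P (InvOpt.feasDist 𝒳 g xhat φtrue) * √((D : ℝ) - 1)
          + u * InvOpt.psi2Norm P (InvOpt.feasDist 𝒳 g xhat φtrue))
      = Lf * InvOpt.psi2Norm P (InvOpt.feasDist 𝒳 g xhat φtrue)
        * ((1 + √Real.pi / √(Real.log 2)) * √6 * C * (3.01 * √((D : ℝ) - 1) + u)) / √N by ring]
  · have hb : 44 * (3 * √((D : ℝ) - 1) + u) ≤ 44 * (3.01 * √((D : ℝ) - 1) + u) := by
      gcongr
      norm_num
    refine le_trans (le_of_eq ?_) ((key _ (le_trans (by positivity) hb)).trans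
      (add_le_add le_rfl (InvOpt.exp_tail_le_three_mul hu hD0 hb)))
    rw [show 44 * Lf * InvOpt.psi2Norm P (InvOpt.feasDist 𝒳 g xhat φtrue) / √N
        * (3.01 * √((D : ℝ) - 1) + u)
      = Lf * InvOpt.psi2Norm P (InvOpt.feasDist 𝒳 g xhat φtrue)
        * (44 * (3.01 * √((D : ℝ) - 1) + u)) / √N by ring]
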